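/- Let $G$ be a finite simple graph with $v$ vertices, and let $\mathcal A_3=\mathbb Z[x]/(x^3)$, graded by $\deg x=1$. For a set $s$ of edges of $G$ let $[G:s]$ be the graph with all the vertices of $G$ and the edges in $s$, and let $k(s)$ be its number of connected components. Fix a linear order of the edges of $G$. Let $H^{i,j}_{\mathcal A_3}(G)$ be the bigraded chromatic graph cohomology of $G$, that is, the cohomology of the complex with cochain groups $C^i=\bigoplus_{|s|=i}\mathcal A_3^{\otimes k(s)}$ (one tensor factor, over $\mathbb Z$, for each component of $[G:s]$; $C^{i,j}$ is the part of total degree $j$) and differential $d=\sum_{e\notin s}(-1)^{t(s,e)}d_e$ on the summand of $s$. Here $t(s,e)$ is the number of edges of $s$ that precede $e$, and $d_e$ maps the summand of $s$ to that of $s\cup\{e\}$: it multiplies the two factors of the components joined by $e$ if $e$ joins different components of $[G:s]$, and it is the identity otherwise. Let $X_4(G)$ be the 2-dimensional cell complex obtained from $G$ by attaching a 2-cell along every 4-cycle of $G$. Then: 1. If $G$ contains a triangle (a 3-cycle), then $H^{1,2v-3}_{\mathcal A_3}(G)$ contains a subgroup isomorphic to $\mathbb Z_3=\mathbb Z/3\mathbb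 Z$. 2. $H^{1,2v-3}_{\mathcal A_3}(G)$ has nontrivial torsion if and only if $G$ contains a triangle or $H_1(X_4(G);\mathbb Z)$ has nontrivial torsion. -/

import Mathlib

open scoped TensorProduct Classical

noncomputable section

namespace ChromaticGraphCohomology

universe u

/- The map `⨂_{c ∈ ι} A → ⨂_{c' ∈ κ} A` induced by a map `p : ι → κ` of finite index sets: the
factors over each fibre of `p` are multiplied together. -/
section Merge

variable (k A : Type*) [CommRing k] [CommRing A] [Algebra k A]
variable {ι κ : Type*} [Fintype ι]

/-- Multiply the entries of a family over the fibres of `p`. -/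
def fibreProd (p : ι → κ) (a : ι → A) : κ → A :=
  fun c' => ∏ c with p c = c', a c

theorem fibreProd_update (p : ι → κ) (a : ι → A) (i : ι) (x : A) :
    fibreProd A p (Function.update a i x) =
      Function.update (fibreProd A p a) (p i)
        (x * ∏ c ∈ (Finset.univ.filter fun c => p c = p i).erase i, a c) := by
  funext c'
  by_cases h : c' = p i
  · subst h
    rw [Function.update_self, fibreProd,
      ← Finset.mul_prod_erase _ _ (show i ∈ Finset.univ.filter fun c => p c = p i by simp),
      Function.update_self]
    congr 1
    refine Finset.prod_congr rfl fun c hc => ?_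
    rw [Function.update_of_ne (Finset.ne_of_mem_erase hc)]
  · rw [Function.update_of_ne h]
    refine Finset.prod_congr rfl fun c hc => ?_
    have hc' : p c = c' := (Finset.mem_filter.mp hc).2
    rw [Function.update_of_ne]
    rintro rfl
    exact h hc'.symm

/-- The linear map `⨂_c a_c ↦ ⨂_{c'} ∏_{p c = c'} a_c`. -/
def merge (p : ι → κ) : (⨂[k] _c : ι, A) →ₗ[k] (⨂[k] _c : κ, A) :=
  PiTensorProduct.lift
    { toFun := fun a => PiTensorProduct.tprod k (fibreProd A p a)
      map_update_add' := by
        intro inst a i x y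
        obtain rfl : inst = Classical.decEq ι := Subsingleton.elim _ _
        simp only [fibreProd_update, add_mul, MultilinearMap.map_update_add]
      map_update_smul' := by
        intro inst a i r x
        obtain rfl : inst = Classical.decEq ι := Subsingleton.elim _ _
        simp only [fibreProd_update, smul_mul_assoc, MultilinearMap.map_update_smul] }

theorem merge_tprod (p : ι → κ) (a : ι → A) :
    merge k A p (PiTensorProduct.tprod k a) = PiTensorProduct.tprod k (fibreProd A p a) := by
  simp [merge]

end Merge

section Complex

variable {V : Type u} (G : SimpleGraph V)

/-- The spanning subgraph `[G:s]`: all vertices of `G`, and the edges in `s`. -/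
def spanning (s : Finset G.edgeSet) : SimpleGraph V :=
  SimpleGraph.fromEdgeSet ((fun e : G.edgeSet => (e : Sym2 V)) '' (s : Set G.edgeSet))

/-- The connected components of `[G:s]`. -/
abbrev Component (s : Finset G.edgeSet) : Type u := (spanning G s).ConnectedComponent

theorem spanning_mono {s t : Finset G.edgeSet} (h : s ⊆ t) : spanning G s ≤ spanning G t :=
  SimpleGraph.fromEdgeSet_mono (Set.image_mono (Finset.coe_subset.mpr h))

/-- Adding edges to `s` maps the components of `[G:s]` onto those of the larger graph. -/
def componentMap {s t : Finset G.edgeSet} (h : s ⊆ t) : Component G s → Component G t :=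
  SimpleGraph.ConnectedComponent.map (SimpleGraph.Hom.ofLE (spanning_mono G h))

variable [Fintype V]

/-- The cochains `⨁_{s ⊆ E} A^{⊗ k(s)}` of the chromatic graph complex over the commutative
`k`-algebra `A`: one tensor factor `A` for each component of `[G:s]` (the set of states `s` is
finite, so that the direct sum is a product). -/
abbrev Cochain (k A : Type*) [CommRing k] [CommRing A] [Algebra k A] : Type _ :=
  (s : Finset G.edgeSet) → ⨂[k] _c : Component G s, A

/-- The differential `d = ∑_{e ∉ s} (-1)^{t(s,e)} d_e`, where `t(s,e)` is the number of edges of `s`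
that precede `e` in the chosen order of the edges. The map `d_e`, from the summand of `s` to that
of `s ∪ {e}`, multiplies the two factors joined by `e` if `e` joins different components of `[G:s]`,
and is the identity otherwise. The component of `d f` at a state `t` collects the contributions
of all states `s = t - e` with `e ∈ t`. -/
def differential (k A : Type*) [CommRing k] [CommRing A] [Algebra k A]
    (ord : LinearOrder G.edgeSet) : Cochain G k A →ₗ[k] Cochain G k A :=
  LinearMap.pi fun t => ∑ e ∈ t,
    ((-1 : k) ^ ((t.erase e).filter fun e' => ord.lt e' e).card) •
      (merge k A (componentMap G (Finset.erase_subset e t)) ∘ₗ LinearMap.proj (t.erase e))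

/-- The algebra `𝒜_m = ℤ[x]/(x^m)` of truncated polynomials. -/
abbrev Trunc (m : ℕ) : Type := AdjoinRoot (Polynomial.X ^ m : Polynomial ℤ)

/-- The degree `j` part of `𝒜_m^{⊗ k(s)}`, where `x` has degree `1`: it is spanned by the enhanced
states, that is by the tensors `⨂_c x^{a_c}` with `0 ≤ a_c < m` and `∑ a_c = j`. -/
def degreePart (m : ℕ) (s : Finset G.edgeSet) (j : ℤ) :
    Submodule ℤ (⨂[ℤ] _c : Component G s, Trunc m) :=
  Submodule.span ℤ
    {z | ∃ a : Component G s → Fin m, (∑ c, ((a c : ℕ) : ℤ)) = j ∧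
      z = PiTensorProduct.tprod ℤ fun c => AdjoinRoot.root (Polynomial.X ^ m) ^ (a c : ℕ)}

/-- The bigraded piece `C^{i,j}`: cochains supported on the states with exactly `i` edges, and
homogeneous of degree `j`. -/
def cochainPart (m : ℕ) (i j : ℤ) : Submodule ℤ (Cochain G ℤ (Trunc m)) where
  carrier := {f | (∀ s, (s.card : ℤ) ≠ i → f s = 0) ∧ ∀ s, f s ∈ degreePart G m s j}
  add_mem' := by
    rintro f g ⟨hf, hf'⟩ ⟨hg, hg'⟩
    exact ⟨fun s hs => by simp [hf s hs, hg s hs], fun s => add_mem (hf' s) (hg' s)⟩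
  zero_mem' := ⟨fun _ _ => rfl, fun _ => zero_mem _⟩
  smul_mem' := by
    rintro r f ⟨hf, hf'⟩
    exact ⟨fun s hs => by simp [hf s hs], fun s => Submodule.smul_mem _ r (hf' s)⟩

/-- The cocycles in `C^{i,j}`. -/
def cocycles (m : ℕ) (ord : LinearOrder G.edgeSet) (i j : ℤ) :
    Submodule ℤ (Cochain G ℤ (Trunc m)) :=
  cochainPart G m i j ⊓ LinearMap.ker (differential G ℤ (Trunc m) ord)

/-- The coboundaries in `C^{i,j}`, that is the image of `C^{i-1,j}`. -/
def coboundaries (m : ℕ) (ord : LinearOrder G.edgeSet) (i j : ℤ) :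
    Submodule ℤ (Cochain G ℤ (Trunc m)) :=
  (cochainPart G m (i - 1) j).map (differential G ℤ (Trunc m) ord)

/-- The chromatic graph cohomology `H^{i,j}_{𝒜_m}(G)`. -/
abbrev Cohomology (m : ℕ) (ord : LinearOrder G.edgeSet) (i j : ℤ) : Type u :=
  cocycles G m ord i j ⧸ (coboundaries G m ord i j).submoduleOf (cocycles G m ord i j)

end Complex

/- The cellular homology `H_1` of the 2-dimensional cell complex `X_4(G)`, obtained from `G` by
attaching one 2-cell along every 4-cycle of `G`. -/
section SquareComplex

variable {V : Type u} [Fintype V] (G : SimpleGraph V)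

/-- The 1-chain given by the oriented 1-cell `a → b`. A 1-chain is written as an antisymmetric
function of two vertices, whose value at `(a, b)` is the coefficient of `a → b`. -/
def orientedEdge (a b : V) : V → V → ℤ :=
  Pi.single a (Pi.single b 1) - Pi.single b (Pi.single a 1)

/-- The cellular 1-chains, on which `b → a` is the negative of `a → b`. -/
def oneChains : Submodule ℤ (V → V → ℤ) where
  carrier := {c | (∀ a b, c b a = - c a b) ∧ ∀ a b, ¬ G.Adj a b → c a b = 0}
  add_mem' := by
    rintro c c' ⟨h, h'⟩ ⟨k, k'⟩
    refine ⟨fun a b => ?_, fun a b hab => ?_⟩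
    · simp only [Pi.add_apply, h a b, k a b]; ring
    · simp only [Pi.add_apply, h' a b hab, k' a b hab, add_zero]
  zero_mem' := by simp
  smul_mem' := by
    rintro r c ⟨h, h'⟩
    refine ⟨fun a b => ?_, fun a b hab => ?_⟩
    · simp only [Pi.smul_apply, h a b, smul_neg]
    · simp only [Pi.smul_apply, h' a b hab, smul_zero]

/-- The cellular boundary of 1-chains; the boundary of `a → b` is `b - a`. -/
def boundaryOne : (V → V → ℤ) →ₗ[ℤ] (V → ℤ) where
  toFun c := fun b => ∑ a, c a b
  map_add' c c' := by funext b; simp [Finset.sum_add_distrib]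
  map_smul' r c := by funext b; simp [Finset.mul_sum]

/-- The cellular 1-cycles. -/
def oneCycles : Submodule ℤ (V → V → ℤ) := oneChains G ⊓ LinearMap.ker boundaryOne

/-- The cellular 1-boundaries of `X_4(G)`: they are generated by the boundaries of the 2-cells,
which are attached along the 4-cycles `a → b → c → d → a` of `G`. (The starting point and the
direction of a 4-cycle only affect the sign of this boundary.) -/
def squareBoundaries : Submodule ℤ (V → V → ℤ) :=
  Submodule.span ℤ
    {z | ∃ a b c d : V, G.Adj a b ∧ G.Adj b c ∧ G.Adj c d ∧ G.Adj d a ∧ a ≠ c ∧ b ≠ d ∧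
      z = orientedEdge a b + orientedEdge b c + orientedEdge c d + orientedEdge d a}

/-- The homology group `H_1(X_4(G)) = H_1(X_4(G); ℤ)`. -/
abbrev SquareH1 : Type u :=
  oneCycles G ⧸ (squareBoundaries G).submoduleOf (oneCycles G)

end SquareComplex

end ChromaticGraphCohomology

end

noncomputable section

namespace ChromaticGraphCohomology

/-! ### Torsion of a quotient as failure of saturation, and a dual criterion. -/

section Saturation

variable {M : Type*} [AddCommGroup M]

/-! Measure degrees by the deficit from the top degree `2k(s)`. In degree `2v - 3` a state with two
edges has at most `v - 2` components, hence no cochains, so every 1-cochain is a cocycle and the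
cohomology is the cokernel of an integer matrix. The rows are indexed by an edge `ab` and a
component of `[G:{ab}]` (deficit 1). The columns (deficit 3) are of two kinds: exponents 0 at `p`, 1
at `q`, with coefficient `y₁ p q`, or exponent 1 on a triple `T`, with coefficient `y₂ T`. The
coordinates of the differential are `y₁ a c + y₁ b c + y₂ {a,b,c}` for `c` off the edge, and `y₁ a b
+ y₁ b a`. Absence of torsion means that a differential divisible by `n` is `n` times a
differential; this is `SaturatedAt` (`torsion_quotient_eq_bot_iff`, `saturated_coboundaries_iff`).

A triangle violates this at 3. With `y₁ p q = f q - f p` and `y₂ T` the sum of `f` over `T`, the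
coordinates are `3 f c` and 0. Division by 3 is impossible when `f` is the indicator of one corner,
because modulo the edge relations the three coordinates of a triangle sum to `3 y₂ T`
(`not_saturatedAt_three_of_triangle`).

Without triangles, a kernel element is antisymmetric on edges, and eliminating `y₂` along a path `a
- b - c` gives `y₁ a c - y₁ c a = y₁ c b + y₁ b a`. The left side does not see `b`, so the only
constraint on the edge values is that their circulation around each 4-cycle is 0
(`exists_extension`). Edge values are thus functionals on 1-chains restricted by the boundaries of
the 2-cells. Saturation of those boundaries is equivalent to being able to correct any functional
divisible by `n` on them, modulo `n`, to one that vanishes there (`exists_correction_of_saturated`,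
`saturated_of_exists_correction`). This matches torsion of `H_1(X_4(G))` with torsion of the
cohomology (`torsion_squareH1_eq_bot_iff_saturatedAt`). -/

theorem torsion_quotient_eq_bot_iff (K S : Submodule ℤ M) :
    AddCommGroup.torsion (K ⧸ S.submoduleOf K) = ⊥ ↔
      ∀ n : ℕ, 0 < n → ∀ x ∈ K, n • x ∈ S → x ∈ S := by
  have key : ∀ (n : ℕ) (x : K), n • (S.submoduleOf K).mkQ x = 0 ↔ n • (x : M) ∈ S := by
    intro n x
    rw [← map_nsmul, Submodule.mkQ_apply, Submodule.Quotient.mk_eq_zero, Submodule.submoduleOf,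
      Submodule.mem_comap]
    simp
  rw [eq_bot_iff]
  constructor
  · intro h n hn x hx hnx
    have hx' : (S.submoduleOf K).mkQ ⟨x, hx⟩ ∈ AddCommGroup.torsion (K ⧸ S.submoduleOf K) :=
      isOfFinAddOrder_iff_nsmul_eq_zero.2 ⟨n, hn, (key n ⟨x, hx⟩).2 hnx⟩
    have h1 := h hx'
    rw [AddSubgroup.mem_bot] at h1
    simpa using (key 1 ⟨x, hx⟩).1 (by rw [h1, smul_zero])
  · intro h q hq
    obtain ⟨x, rfl⟩ := (S.submoduleOf K).mkQ_surjective q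
    obtain ⟨n, hn, hx⟩ := isOfFinAddOrder_iff_nsmul_eq_zero.1 hq
    have hxS := h n hn x x.2 ((key n x).1 hx)
    rw [AddSubgroup.mem_bot]
    simpa using (key 1 x).2 (by simpa using hxS)

theorem exists_zmod_embedding (p : ℕ) [Fact p.Prime] (K S : Submodule ℤ M) {x : M} (hx : x ∈ K)
    (hpx : p • x ∈ S) (hxS : x ∉ S) :
    ∃ φ : ZMod p →+ (K ⧸ S.submoduleOf K), Function.Injective φ := by
  set q : K ⧸ S.submoduleOf K := (S.submoduleOf K).mkQ ⟨x, hx⟩ with hq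
  have hq0 : q ≠ 0 := by
    intro h
    rw [hq, Submodule.mkQ_apply, Submodule.Quotient.mk_eq_zero] at h
    exact hxS h
  have hpq : p • q = 0 := by
    rw [hq, ← map_nsmul, Submodule.mkQ_apply, Submodule.Quotient.mk_eq_zero]
    exact hpx
  have hord : addOrderOf q = p := addOrderOf_eq_prime hpq hq0
  refine ⟨ZMod.lift p ⟨zmultiplesHom _ q, by simpa using hpq⟩, ?_⟩
  rw [ZMod.lift_injective]
  intro m hm
  rw [ZMod.intCast_zmod_eq_zero_iff_dvd, ← hord]
  exact addOrderOf_dvd_iff_zsmul_eq_zero.2 (by simpa using hm)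

variable [Module.Finite ℤ M]

/-- Functionals divisible by `n` on a saturated submodule can be corrected by a multiple of `n` so
as to vanish there. -/
theorem exists_correction_of_saturated (S : Submodule ℤ M)
    (hS : ∀ n : ℕ, 0 < n → ∀ x : M, n • x ∈ S → x ∈ S) (n : ℤ) (hn : n ≠ 0) (φ : M →ₗ[ℤ] ℤ)
    (hφ : ∀ s ∈ S, n ∣ φ s) : ∃ ψ : M →ₗ[ℤ] ℤ, ∀ s ∈ S, φ s + n * ψ s = 0 := by
  have : Module.IsTorsionFree ℤ (M ⧸ S) := by
    rw [Module.isTorsionFree_int_iff_isAddTorsionFree]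
    refine ⟨fun k hk p q hpq => ?_⟩
    obtain ⟨x, rfl⟩ := S.mkQ_surjective p
    obtain ⟨y, rfl⟩ := S.mkQ_surjective q
    rw [← sub_eq_zero, ← map_sub, Submodule.mkQ_apply, Submodule.Quotient.mk_eq_zero]
    refine hS k (Nat.pos_of_ne_zero hk) _ ?_
    rw [← Submodule.Quotient.mk_eq_zero, ← Submodule.mkQ_apply, map_nsmul, map_sub, smul_sub,
      sub_eq_zero]
    exact hpq
  -- The quotient is finitely generated and torsion-free over ℤ, hence free, so `S` is a direct
  -- summand. The correction is `-φ/n` on the component in `S`.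
  obtain ⟨r, hr⟩ := S.mkQ.exists_rightInverse_of_surjective (Submodule.range_mkQ S)
  have hproj : ∀ x, x - r (S.mkQ x) ∈ S := by
    intro x
    rw [← Submodule.Quotient.mk_eq_zero, ← Submodule.mkQ_apply, map_sub, sub_eq_zero]
    exact (LinearMap.congr_fun hr (S.mkQ x)).symm
  choose q hq using fun x => hφ _ (hproj x)
  refine ⟨-
    { toFun := q
      map_add' := fun x y => mul_left_cancel₀ hn ?_
      map_smul' := fun c x => mul_left_cancel₀ hn ?_ }, fun s hs => ?_⟩
  · have h0 : S.mkQ s = 0 := by simpa using hs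
    have := hq s
    rw [h0, map_zero, sub_zero] at this
    simp [this]
  · rw [mul_add, ← hq, ← hq, ← hq]
    simp only [map_add, map_sub]
    ring
  · rw [eq_intCast, Int.cast_id, smul_eq_mul, mul_left_comm, ← hq, ← hq]
    simp only [map_smul, map_sub, smul_eq_mul]
    ring

/-- If functionals divisible by `n` on `S` can be corrected so as to vanish on `S`, then `S` is
saturated. -/
theorem saturated_of_exists_correction [Module.Free ℤ M] (S : Submodule ℤ M)
    (h : ∀ n : ℤ, n ≠ 0 → ∀ φ : M →ₗ[ℤ] ℤ, (∀ s ∈ S, n ∣ φ s) →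
      ∃ ψ : M →ₗ[ℤ] ℤ, ∀ s ∈ S, φ s + n * ψ s = 0)
    (m : ℕ) (hm : 0 < m) (x : M) (hx : m • x ∈ S) : x ∈ S := by
  by_contra hxS
  -- A ℚ/ℤ-valued character detects the class of `x`. On the free module `M` it lifts to `φ / N`
  -- with `φ` integral and `N` a common denominator, so killing `S` means that `N` divides `φ` on
  -- `S`.
  obtain ⟨χ, hχ⟩ := CharacterModule.exists_character_apply_ne_zero_of_ne_zero
    (A := M ⧸ S) (a := S.mkQ x) (by simpa using hxS)
  let b := Module.Free.chooseBasis ℤ M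
  choose r hr using fun i => QuotientAddGroup.mk_surjective (χ (S.mkQ (b i)))
  set N : ℕ := ∏ i, (r i).den with hN
  have hN0 : (N : ℚ) ≠ 0 := by
    rw [hN]
    exact_mod_cast Finset.prod_ne_zero_iff.2 fun i _ => (r i).den_nz
  have hint : ∀ i, ∃ z : ℤ, (z : ℚ) = r i * N := by
    intro i
    obtain ⟨c, hc⟩ : (r i).den ∣ N := Finset.dvd_prod_of_mem _ (Finset.mem_univ i)
    refine ⟨(r i).num * c, ?_⟩
    rw [hc]
    push_cast
    rw [← mul_assoc, Rat.mul_den_eq_num]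
  choose z hz using hint
  let φ : M →ₗ[ℤ] ℤ := b.constr ℤ z
  have hφ : ∀ y, χ (S.mkQ y) = (((φ y : ℚ) / N : ℚ) : AddCircle (1 : ℚ)) := by
    intro y
    let α : M →+ AddCircle (1 : ℚ) := χ.comp S.mkQ.toAddMonoidHom
    let β : M →+ AddCircle (1 : ℚ) := (QuotientAddGroup.mk' _).comp
      (((AddMonoidHom.mulRight (N : ℚ)⁻¹).comp (Int.castAddHom ℚ)).comp φ.toAddMonoidHom)
    have hαβ : α.toIntLinearMap = β.toIntLinearMap := by
      refine b.ext fun i => ?_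
      have h1 : φ (b i) = z i := by simp [φ]
      change χ (S.mkQ (b i)) = ((((φ (b i) : ℤ) : ℚ) * (N : ℚ)⁻¹ : ℚ) : AddCircle (1 : ℚ))
      rw [h1, hz, mul_inv_cancel_right₀ hN0]
      exact (hr i).symm
    exact LinearMap.congr_fun hαβ y
  have hzero : ∀ y, χ (S.mkQ y) = 0 ↔ (N : ℤ) ∣ φ y := by
    intro y
    rw [hφ, AddCircle.coe_eq_zero_iff]
    constructor
    · rintro ⟨c, hc⟩
      refine ⟨c, ?_⟩
      rw [eq_div_iff hN0] at hc
      have : ((φ y : ℤ) : ℚ) = ((N * c : ℤ) : ℚ) := by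
        rw [← hc]; push_cast; simp [mul_comm]
      exact_mod_cast this
    · rintro ⟨c, hc⟩
      refine ⟨c, ?_⟩
      rw [hc, eq_div_iff hN0]
      push_cast
      simp [mul_comm]
  obtain ⟨ψ, hψ⟩ := h N (by exact_mod_cast hN0) φ fun s hs => (hzero s).1 (by
    rw [show S.mkQ s = 0 by simpa using hs]; exact map_zero χ)
  have h1 := hψ _ hx
  rw [map_nsmul, map_nsmul, nsmul_eq_mul, nsmul_eq_mul, mul_left_comm, ← mul_add] at h1
  have h2 := (mul_eq_zero.1 h1).resolve_left (by exact_mod_cast hm.ne')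
  exact hχ ((hzero x).2 ⟨-ψ x, by linarith⟩)

end Saturation

/-! ### The differential in coordinates: the triangle obstruction and the triangle-free extension.
-/

section Combinatorics

universe u

theorem exists_asymm_total (V : Type u) : ∃ lt : V → V → Prop,
    (∀ a b, lt a b → ¬ lt b a) ∧ ∀ a b, a ≠ b → lt a b ∨ lt b a :=
  ⟨WellOrderingRel, fun _ _ => asymm, fun a b h =>
    (trichotomous_of WellOrderingRel a b).imp_right fun h' => h'.resolve_left h⟩

variable {V : Type u}

/-- The differential `C^{0,2v-3} → C^{1,2v-3}` in coordinates, at the generator given by the edge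
`ab` and a third vertex `c`. Here `y₁ a b` is the coefficient of the monomial with exponent `0` at
`a`, `1` at `b` and `2` elsewhere, and `y₂ T` that of the monomial with exponent `1` on `T` and
`2` elsewhere. -/
def vertexCoeff (y₁ : V → V → ℤ) (y₂ : Finset V → ℤ) (a b c : V) : ℤ :=
  y₁ a c + y₁ b c + y₂ {a, b, c}

/-- Every pair `(y₁, y₂)` whose differential is divisible by `n` has the differential of `n` times
another pair. -/
def SaturatedAt (G : SimpleGraph V) (n : ℤ) : Prop :=
  ∀ (y₁ : V → V → ℤ) (y₂ : Finset V → ℤ),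
    (∀ a b c, G.Adj a b → c ≠ a → c ≠ b → n ∣ vertexCoeff y₁ y₂ a b c) →
    (∀ a b, G.Adj a b → n ∣ y₁ a b + y₁ b a) →
    ∃ (z₁ : V → V → ℤ) (z₂ : Finset V → ℤ),
      (∀ a b c, G.Adj a b → c ≠ a → c ≠ b →
        vertexCoeff y₁ y₂ a b c = n * vertexCoeff z₁ z₂ a b c) ∧
      ∀ a b, G.Adj a b → y₁ a b + y₁ b a = n * (z₁ a b + z₁ b a)

/-- A triangle obstructs saturation at `3`. -/
theorem not_saturatedAt_three_of_triangle (G : SimpleGraph V) {a b c : V} (hab : G.Adj a b)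
    (hbc : G.Adj b c) (hca : G.Adj c a) : ¬ SaturatedAt G 3 := by
  intro h
  let f : V → ℤ := fun v => if v = c then 1 else 0
  have hy : ∀ p q r, p ≠ q → r ≠ p → r ≠ q →
      vertexCoeff (fun p q => f q - f p) (fun T => ∑ v ∈ T, f v) p q r = 3 * f r := by
    intro p q r hpq hrp hrq
    rw [vertexCoeff, Finset.sum_insert (by simp [hpq, hrp.symm]),
      Finset.sum_insert (by simpa using hrq.symm), Finset.sum_singleton]
    ring
  obtain ⟨z₁, z₂, hz, hz'⟩ := h (fun p q => f q - f p) (fun T => ∑ v ∈ T, f v)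
    (fun p q r hpq hrp hrq => ⟨f r, hy p q r hpq.ne hrp hrq⟩)
    (fun p q _ => ⟨0, by ring⟩)
  have e1 := hz a b c hab hca.ne hbc.ne'
  have e2 := hz b c a hbc hab.ne hca.ne'
  have e3 := hz c a b hca hbc.ne hab.ne'
  rw [hy _ _ _ hab.ne hca.ne hbc.ne'] at e1
  rw [hy _ _ _ hbc.ne hab.ne hca.ne'] at e2
  rw [hy _ _ _ hca.ne hbc.ne hab.ne'] at e3
  have t1 : ({b, c, a} : Finset V) = {a, b, c} := by ext; simp; tauto
  have t2 : ({c, a, b} : Finset V) = {a, b, c} := by ext; simp; tauto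
  have e4 := hz' a b hab
  have e5 := hz' b c hbc
  have e6 := hz' c a hca
  have fa : f a = 0 := if_neg hca.ne'
  have fb : f b = 0 := if_neg hbc.ne
  have fc : f c = 1 := if_pos rfl
  rw [fa] at e2
  rw [fb] at e3
  rw [fc] at e1
  simp only [vertexCoeff, t1, t2] at e1 e2 e3
  -- Adding `e1`, `e2`, `e3` and cancelling the symmetric sums by `e4`, `e5`, `e6` leaves `3 * z₂
  -- {a, b, c} = 1`.
  omega

/-- In a triangle-free graph, an antisymmetric function `w` on the oriented edges that vanishes
modulo `k` on the `4`-cycles extends to a pair `(z₁, z₂)` with differential divisible by `k`, and the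
extension may be prescribed modulo `N`. -/
theorem exists_extension (G : SimpleGraph V)
    (hG : ∀ a b c, G.Adj a b → G.Adj b c → ¬ G.Adj c a) (k N : ℤ) (w : V → V → ℤ)
    (hw : ∀ a b, w b a = -w a b)
    (hsq : ∀ a b c d, G.Adj a b → G.Adj b c → G.Adj c d → G.Adj d a → a ≠ c → b ≠ d →
      k ∣ w a b + w b c + w c d + w d a)
    (y₁ : V → V → ℤ) (y₂ : Finset V → ℤ)
    (h₂ : ∀ a b c, G.Adj a b → c ≠ a → c ≠ b → N ∣ vertexCoeff y₁ y₂ a b c)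
    (hwy : ∀ a b, G.Adj a b → N ∣ w a b - y₁ a b) :
    ∃ (z₁ : V → V → ℤ) (z₂ : Finset V → ℤ), (∀ a b, G.Adj a b → z₁ a b = w a b) ∧
      (∀ a b c, G.Adj a b → c ≠ a → c ≠ b → k ∣ vertexCoeff z₁ z₂ a b c) ∧
      (∀ a b, a ≠ b → N ∣ z₁ a b - y₁ a b) ∧ ∀ T, N ∣ z₂ T - y₂ T := by
  obtain ⟨lt, hlt, hlt'⟩ := exists_asymm_total V
  let P : V → V → Prop := fun a b => lt b a ∧ ∃ m, G.Adj a m ∧ G.Adj m b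
  -- On a non-adjacent pair with a common neighbour only the difference of the two values is forced.
  -- One order keeps its value from `y₁` and the other absorbs the difference, through a chosen
  -- midpoint.
  let z₁ : V → V → ℤ := fun a b =>
    if G.Adj a b then w a b
    else if h : P a b then y₁ b a + (w b h.2.choose + w h.2.choose a) else y₁ a b
  have hedge : ∀ a b, G.Adj a b → z₁ a b = w a b := fun a b h => if_pos h
  -- the defect of symmetry of `z₁` along a path of length two
  have hpath : ∀ a m b, G.Adj a m → G.Adj m b → lt b a →
      k ∣ z₁ a b - z₁ b a - (w b m + w m a) := by
    intro a m b ham hmb hba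
    have hnab : ¬ G.Adj a b := fun h => hG a m b ham hmb h.symm
    have hP : P a b := ⟨hba, m, ham, hmb⟩
    have hP' : ¬ P b a := fun h => hlt _ _ hba h.1
    have e1 : z₁ a b = y₁ b a + (w b hP.2.choose + w hP.2.choose a) := by
      simp only [z₁, if_neg hnab, dif_pos hP]
    have e2 : z₁ b a = y₁ b a := by
      simp only [z₁, if_neg (fun h : G.Adj b a => hnab h.symm), dif_neg hP']
    obtain ⟨hm1, hm2⟩ := hP.2.choose_spec
    set m' := hP.2.choose
    rw [e1, e2]
    by_cases hmm : m' = m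
    · rw [hmm]; simp
    -- Two different midpoints form a 4-cycle with `a` and `b`, so changing the midpoint costs a
    -- multiple of `k`.
    · obtain ⟨c, hc⟩ := hsq b m' a m hm2.symm hm1.symm ham hmb (fun h => hlt _ _ hba (h ▸ hba)) hmm
      refine ⟨c, ?_⟩
      rw [← hc, hw b m, hw m a]
      ring
  have hpath' : ∀ a m b, G.Adj a m → G.Adj m b → a ≠ b →
      k ∣ z₁ a b - z₁ b a - (w b m + w m a) := by
    intro a m b ham hmb hab
    rcases hlt' a b hab with h | h
    · obtain ⟨c, hc⟩ := hpath b m a hmb.symm ham.symm h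
      exact ⟨-c, by linarith [hw b m, hw m a]⟩
    · exact hpath a m b ham hmb h
  have hswap : ∀ a b c, G.Adj a b → G.Adj b c → a ≠ c →
      k ∣ z₁ a c + z₁ b c - (z₁ b a + z₁ c a) := by
    intro a b c hab hbc hac
    obtain ⟨x, hx⟩ := hpath' a b c hab hbc hac
    exact ⟨x, by linarith [hedge b c hbc, hedge b a hab.symm, hw b c]⟩
  have hzy : ∀ a b, a ≠ b → N ∣ z₁ a b - y₁ a b := by
    intro a b hab
    by_cases h : G.Adj a b
    · rw [hedge a b h]; exact hwy a b h
    · by_cases hP : P a b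
      · have e1 : z₁ a b = y₁ b a + (w b hP.2.choose + w hP.2.choose a) := by
          simp only [z₁, if_neg h, dif_pos hP]
        obtain ⟨hm1, hm2⟩ := hP.2.choose_spec
        set m := hP.2.choose
        rw [e1]
        obtain ⟨c1, d1⟩ := h₂ m b a hm2 hm1.ne hab
        obtain ⟨c2, d2⟩ := h₂ a m b hm1 hab.symm hm2.ne'
        obtain ⟨c3, d3⟩ := hwy m b hm2
        obtain ⟨c4, d4⟩ := hwy m a hm1.symm
        have t : ({m, b, a} : Finset V) = {a, m, b} := by ext; simp; tauto
        simp only [vertexCoeff, t] at d1 d2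
        exact ⟨c1 - c2 + c4 - c3, by linarith [hw m b]⟩
      · have e1 : z₁ a b = y₁ a b := by simp only [z₁, if_neg h, dif_neg hP]
        rw [e1]; simp
  let Q : Finset V → V × V × V → Prop := fun T t =>
    G.Adj t.1 t.2.1 ∧ t.2.2 ≠ t.1 ∧ t.2.2 ≠ t.2.1 ∧ T = {t.1, t.2.1, t.2.2}
  -- Any edge inside `T` determines the value; one is chosen. A second edge in `T` shares a vertex
  -- with it, and `hswap` shows that it gives the same value modulo `k`.
  let z₂ : Finset V → ℤ := fun T =>
    if h : ∃ t, Q T t then -(z₁ h.choose.1 h.choose.2.2 + z₁ h.choose.2.1 h.choose.2.2) else y₂ T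
  refine ⟨z₁, z₂, hedge, ?_, hzy, ?_⟩
  · intro a b c hab hca hcb
    have hQ : ∃ t, Q {a, b, c} t := ⟨(a, b, c), hab, hca, hcb, rfl⟩
    have e : z₂ {a, b, c} = -(z₁ hQ.choose.1 hQ.choose.2.2 + z₁ hQ.choose.2.1 hQ.choose.2.2) :=
      dif_pos hQ
    obtain ⟨q1, q2, q3, q4⟩ := hQ.choose_spec
    rw [vertexCoeff, e]
    generalize hQ.choose = t at q1 q2 q3 q4
    obtain ⟨p, q, r⟩ := t
    have hp : p ∈ ({a, b, c} : Finset V) := by rw [q4]; simp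
    have hq : q ∈ ({a, b, c} : Finset V) := by rw [q4]; simp
    have hr : r ∈ ({a, b, c} : Finset V) := by rw [q4]; simp
    clear q4 e hQ
    simp only [Finset.mem_insert, Finset.mem_singleton] at hp hq hr q1 q2 q3 ⊢
    -- The vertex off the chosen edge is `a`, `b` or `c`. Only in the last case is the chosen edge
    -- `ab` itself.
    rcases hr with rfl | rfl | rfl
    · rcases hp with rfl | rfl | rfl
      · exact absurd rfl q2
      all_goals
        rcases hq with rfl | rfl | rfl
        all_goals first | exact absurd rfl q3 | exact absurd rfl q1.ne | skip
      · obtain ⟨x, hx⟩ := hswap _ _ _ hab q1 hca.symm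
        exact ⟨x, by linarith⟩
      · obtain ⟨x, hx⟩ := hswap _ _ _ hab q1.symm hca.symm
        exact ⟨x, by linarith⟩
    · rcases hp with rfl | rfl | rfl
      rotate_left
      · exact absurd rfl q2
      all_goals
        rcases hq with rfl | rfl | rfl
        all_goals first | exact absurd rfl q3 | exact absurd rfl q1.ne | skip
      · obtain ⟨x, hx⟩ := hswap _ _ _ hab.symm q1.symm hcb.symm
        exact ⟨x, by linarith⟩
      · obtain ⟨x, hx⟩ := hswap _ _ _ hab.symm q1 hcb.symm
        exact ⟨x, by linarith⟩
    · rcases hp with rfl | rfl | rfl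
      rotate_right
      · exact absurd rfl q2
      all_goals
        rcases hq with rfl | rfl | rfl
        all_goals first | exact absurd rfl q3 | exact absurd rfl q1.ne | skip
      · exact ⟨0, by ring⟩
      · exact ⟨0, by ring⟩
  · intro T
    by_cases h : ∃ t, Q T t
    · have e : z₂ T = -(z₁ h.choose.1 h.choose.2.2 + z₁ h.choose.2.1 h.choose.2.2) := dif_pos h
      obtain ⟨q1, q2, q3, q4⟩ := h.choose_spec
      set t := h.choose
      obtain ⟨c, d⟩ := h₂ _ _ _ q1 q2 q3
      rw [vertexCoeff, ← q4] at d
      obtain ⟨c1, d1⟩ := hzy t.1 t.2.2 q2.symm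
      obtain ⟨c2, d2⟩ := hzy t.2.1 t.2.2 q3.symm
      exact ⟨-(c + c1 + c2), by linarith⟩
    · have e : z₂ T = y₂ T := dif_neg h
      rw [e]; simp

end Combinatorics

/-! ### Torsion of the first homology of the square complex, for triangle-free graphs. -/

section SquareComplexTorsion

universe u

variable {V : Type u}

theorem orientedEdge_swap (a b : V) : orientedEdge b a = -orientedEdge a b := by
  simp [orientedEdge]

theorem exists_functional_of_antisymm [Fintype V] (t : V → V → ℤ) (ht : ∀ a b, t b a = -t a b) :
    ∃ ψ : (V → V → ℤ) →ₗ[ℤ] ℤ, ∀ a b, ψ (orientedEdge a b) = t a b := by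
  obtain ⟨lt, hlt, hlt'⟩ := exists_asymm_total V
  -- Only one orientation of each pair is read off, since `orientedEdge` has entries at both and
  -- reading both would give `2 * t a b`.
  let u : V → V → ℤ := fun a b => if lt a b then t a b else 0
  let ψ : (V → V → ℤ) →ₗ[ℤ] ℤ :=
    ∑ a, ∑ b, u a b • ((LinearMap.proj b : (V → ℤ) →ₗ[ℤ] ℤ) ∘ₗ
      (LinearMap.proj a : (V → V → ℤ) →ₗ[ℤ] V → ℤ))
  have hs : ∀ a b, ψ (Pi.single a (Pi.single b 1)) = u a b := by
    intro a b
    simp only [ψ, LinearMap.sum_apply, LinearMap.smul_apply, LinearMap.comp_apply,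
      LinearMap.proj_apply, smul_eq_mul]
    rw [Finset.sum_eq_single a, Finset.sum_eq_single b]
    · simp
    · intro c _ hc
      simp [hc]
    · simp
    · intro c _ hc
      simp [hc]
    · simp
  refine ⟨ψ, fun a b => ?_⟩
  rw [orientedEdge, map_sub, hs, hs]
  by_cases hab : a = b
  · subst hab
    linarith [ht a a]
  · rcases hlt' a b hab with h | h
    · simp [u, h, hlt _ _ h]
    · simp [u, h, hlt _ _ h, ht a b]

variable (G : SimpleGraph V)

theorem orientedEdge_mem_oneChains {a b : V} (h : G.Adj a b) : orientedEdge a b ∈ oneChains G := by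
  have hab := h.ne
  refine ⟨fun p q => ?_, fun p q hpq => ?_⟩
  · by_cases h1 : p = a <;> by_cases h2 : p = b <;> by_cases h3 : q = a <;> by_cases h4 : q = b <;>
      simp_all [orientedEdge]
  · have h1 : ¬ (p = a ∧ q = b) := by rintro ⟨rfl, rfl⟩; exact hpq h
    have h2 : ¬ (p = b ∧ q = a) := by rintro ⟨rfl, rfl⟩; exact hpq h.symm
    by_cases h3 : p = a <;> by_cases h4 : p = b <;>
      simp_all [orientedEdge, Pi.single_apply]

variable [Fintype V]

theorem boundaryOne_orientedEdge (a b : V) :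
    boundaryOne (orientedEdge a b) = Pi.single b 1 - Pi.single a 1 := by
  have h : ∀ a b : V, boundaryOne (Pi.single a (Pi.single b 1)) = Pi.single b 1 := by
    intro a b
    funext v
    change ∑ p, (Pi.single a (Pi.single b 1) : V → V → ℤ) p v = _
    rw [Finset.sum_eq_single a (fun p _ hp => by simp [hp]) (by simp), Pi.single_eq_same]
  rw [orientedEdge, map_sub, h, h]

theorem squareBoundaries_le_oneCycles : squareBoundaries G ≤ oneCycles G := by
  rw [squareBoundaries, Submodule.span_le]
  rintro _ ⟨a, b, c, d, hab, hbc, hcd, hda, -, -, rfl⟩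
  refine ⟨add_mem (add_mem (add_mem ?_ ?_) ?_) ?_, ?_⟩
  · exact orientedEdge_mem_oneChains G hab
  · exact orientedEdge_mem_oneChains G hbc
  · exact orientedEdge_mem_oneChains G hcd
  · exact orientedEdge_mem_oneChains G hda
  · rw [SetLike.mem_coe, LinearMap.mem_ker]
    simp only [map_add, boundaryOne_orientedEdge]
    abel

/-- Cycles are cut out by homogeneous linear equations over ℤ. Hence saturation may be tested in the
free module of all functions, where the dual criterion applies. -/
theorem mem_oneCycles_of_nsmul_mem {n : ℕ} (hn : 0 < n) {x : V → V → ℤ}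
    (h : n • x ∈ oneCycles G) : x ∈ oneCycles G := by
  obtain ⟨⟨h1, h2⟩, h3⟩ := h
  have hn' : (n : ℤ) ≠ 0 := by exact_mod_cast hn.ne'
  refine ⟨⟨fun a b => mul_left_cancel₀ hn' ?_, fun a b hab => mul_left_cancel₀ hn' ?_⟩, ?_⟩
  · simpa using h1 a b
  · simpa using h2 a b hab
  · rw [SetLike.mem_coe, LinearMap.mem_ker, map_nsmul] at h3
    rw [SetLike.mem_coe, LinearMap.mem_ker]
    funext v
    have := congrFun h3 v
    simp only [Pi.smul_apply, nsmul_eq_mul, Pi.zero_apply] at this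
    exact (mul_eq_zero.1 this).resolve_left hn'

theorem torsion_squareH1_eq_bot_iff : AddCommGroup.torsion (SquareH1 G) = ⊥ ↔
    ∀ n : ℕ, 0 < n → ∀ x, n • x ∈ squareBoundaries G → x ∈ squareBoundaries G := by
  rw [torsion_quotient_eq_bot_iff]
  exact ⟨fun h n hn x hx => h n hn x
    (mem_oneCycles_of_nsmul_mem G hn (squareBoundaries_le_oneCycles G hx)) hx,
    fun h n hn x _ hx => h n hn x hx⟩

/-- Both directions pass between pairs `(y₁, y₂)` and functionals on 1-chains through the edge
values of `y₁`. The triangle-free extension is used with `k = 0`, `N = n` one way (exact kernel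
element congruent to `y`) and with `k = n`, `N = 1` the other way (differential divisible by `n`, no
prescription). -/
theorem torsion_squareH1_eq_bot_iff_saturatedAt
    (hG : ∀ a b c, G.Adj a b → G.Adj b c → ¬ G.Adj c a) :
    AddCommGroup.torsion (SquareH1 G) = ⊥ ↔ ∀ n : ℕ, 0 < n → SaturatedAt G n := by
  rw [torsion_squareH1_eq_bot_iff]
  constructor
  · intro hS n hn y₁ y₂ h₂ h₁
    have hn' : (n : ℤ) ≠ 0 := by exact_mod_cast hn.ne'
    obtain ⟨lt, hlt, hlt'⟩ := exists_asymm_total V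
    -- On edges `y₁` is antisymmetric only modulo `n`; this makes it exactly so, changing it by
    -- multiples of `n`.
    let u : V → V → ℤ := fun a b => if lt a b then y₁ a b else if lt b a then -y₁ b a else 0
    have hu : ∀ a b, u b a = -u a b := by
      intro a b
      by_cases h : lt a b
      · simp [u, h, hlt _ _ h]
      · by_cases h' : lt b a <;> simp [u, h, h']
    have huy : ∀ a b, G.Adj a b → ∃ c, u a b = y₁ a b + n * c := by
      intro a b hab
      rcases hlt' a b hab.ne with h | h
      · exact ⟨0, by simp [u, h]⟩
      · obtain ⟨c, hc⟩ := h₁ a b hab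
        exact ⟨-c, by simp only [u, if_neg (hlt _ _ h), if_pos h]; linarith⟩
    obtain ⟨φ, hφ⟩ := exists_functional_of_antisymm u hu
    have hpath : ∀ a b c, G.Adj a b → G.Adj b c → a ≠ c →
        ∃ x, u a b + u b c = y₁ c a - y₁ a c + n * x := by
      intro a b c hab hbc hac
      obtain ⟨x₁, e₁⟩ := h₂ a b c hab hac.symm hbc.ne'
      obtain ⟨x₂, e₂⟩ := h₂ b c a hbc hab.ne hac
      obtain ⟨x₃, e₃⟩ := huy b a hab.symm
      obtain ⟨x₄, e₄⟩ := huy b c hbc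
      have t : ({b, c, a} : Finset V) = {a, b, c} := by ext; simp; tauto
      simp only [vertexCoeff, t] at e₁ e₂
      exact ⟨x₁ - x₂ - x₃ + x₄, by linarith [hu b a]⟩
    have hφS : ∀ s ∈ squareBoundaries G, (n : ℤ) ∣ φ s := by
      intro s hs
      induction hs using Submodule.span_induction with
      | mem s hs =>
        obtain ⟨a, b, c, d, hab, hbc, hcd, hda, hac, hbd, rfl⟩ := hs
        -- The 4-cycle splits into paths from `a` to `c` and back, whose values modulo `n` are
        -- opposite.
        obtain ⟨x₁, e₁⟩ := hpath a b c hab hbc hac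
        obtain ⟨x₂, e₂⟩ := hpath c d a hcd hda hac.symm
        simp only [map_add, hφ]
        exact ⟨x₁ + x₂, by linarith⟩
      | zero => simp
      | add s t _ _ hs ht => rw [map_add]; exact dvd_add hs ht
      | smul r s _ hs => rw [map_smul]; exact dvd_mul_of_dvd_right hs r
    obtain ⟨ψ, hψ⟩ := exists_correction_of_saturated _ hS n hn' φ hφS
    let w : V → V → ℤ := fun a b => u a b + n * ψ (orientedEdge a b)
    have hw : ∀ a b, w b a = -w a b := by
      intro a b
      simp only [w]
      rw [orientedEdge_swap, map_neg, hu]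
      ring
    obtain ⟨z₁, z₂, hz1, hz2, hzy1, hzy2⟩ := exists_extension G hG 0 n w hw (by
      intro a b c d hab hbc hcd hda hac hbd
      have := hψ _ (Submodule.subset_span ⟨a, b, c, d, hab, hbc, hcd, hda, hac, hbd, rfl⟩)
      simp only [map_add, hφ] at this
      rw [zero_dvd_iff]
      simp only [w]
      linarith) y₁ y₂ h₂ (by
      intro a b hab
      obtain ⟨x, hx⟩ := huy a b hab
      exact ⟨x + ψ (orientedEdge a b), by simp only [w, hx]; ring⟩)
    have hzy1' : ∀ a b, ∃ x, a ≠ b → z₁ a b = y₁ a b + n * x := by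
      intro a b
      by_cases hab : a = b
      · exact ⟨0, fun h => absurd hab h⟩
      · obtain ⟨x, hx⟩ := hzy1 a b hab
        exact ⟨x, fun _ => by linarith⟩
    choose x₁ hx₁ using hzy1'
    choose x₂ hx₂ using hzy2
    -- The pair `z = y + n x` has zero differential, so that of `y` is `n` times that of `-x`.
    refine ⟨fun a b => -x₁ a b, fun T => -x₂ T, fun a b c hab hca hcb => ?_, fun a b hab => ?_⟩
    · have := zero_dvd_iff.1 (hz2 a b c hab hca hcb)
      simp only [vertexCoeff] at this ⊢
      linarith [hx₁ a c hca.symm, hx₁ b c hcb.symm, hx₂ {a, b, c}]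
    · linarith [hx₁ a b hab.ne, hx₁ b a hab.ne', hz1 a b hab, hz1 b a hab.symm, hw a b]
  · intro hA
    refine saturated_of_exists_correction _ fun n hn φ hφ => ?_
    let w : V → V → ℤ := fun a b => φ (orientedEdge a b)
    have hw : ∀ a b, w b a = -w a b := by
      intro a b
      simp only [w]
      rw [orientedEdge_swap, map_neg]
    obtain ⟨y₁, y₂, hy1, hy2, -, -⟩ := exists_extension G hG n 1 w hw (by
      intro a b c d hab hbc hcd hda hac hbd
      have := hφ _ (Submodule.subset_span ⟨a, b, c, d, hab, hbc, hcd, hda, hac, hbd, rfl⟩)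
      simpa only [map_add] using this) 0 0 (fun _ _ _ _ _ _ => one_dvd _) fun _ _ _ => one_dvd _
    obtain ⟨m, hm⟩ : ∃ m : ℕ, (m : ℤ) = n ∨ (m : ℤ) = -n := by
      rcases Int.natAbs_eq n with h | h
      · exact ⟨n.natAbs, Or.inl h.symm⟩
      · exact ⟨n.natAbs, Or.inr (by omega)⟩
    have hm0 : 0 < m := by omega
    have hmn : ∀ z, n ∣ z → (m : ℤ) ∣ z := by
      rcases hm with h | h <;> simp [h]
    obtain ⟨z₁, z₂, hz2, hz1⟩ := hA m hm0 y₁ y₂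
      (fun a b c hab hca hcb => hmn _ (hy2 a b c hab hca hcb))
      (fun a b hab => ⟨0, by rw [hy1 a b hab, hy1 b a hab.symm, hw]; ring⟩)
    have hz1' : ∀ a b, G.Adj a b → z₁ b a = - z₁ a b := by
      intro a b hab
      have := hz1 a b hab
      rw [hy1 a b hab, hy1 b a hab.symm, hw, neg_add_cancel] at this
      have := (mul_eq_zero.1 this.symm).resolve_left (by exact_mod_cast hm0.ne')
      linarith
    obtain ⟨ψ, hψ⟩ := exists_functional_of_antisymm
      (fun a b => if G.Adj a b then z₁ a b else 0) (by
        intro a b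
        by_cases hab : G.Adj a b
        · simp [hab, hab.symm, hz1' a b hab]
        · simp [hab, G.adj_comm b a])
    have hψ' : ∀ a b, G.Adj a b → ψ (orientedEdge a b) = z₁ a b := fun a b hab => by
      rw [hψ, if_pos hab]
    have hpath : ∀ a b c, G.Adj a b → G.Adj b c → a ≠ c →
        w a b + w b c - m * (z₁ a b + z₁ b c) = (y₁ c a - m * z₁ c a) - (y₁ a c - m * z₁ a c) := by
      intro a b c hab hbc hac
      have e₁ := hz2 a b c hab hac.symm hbc.ne'
      have e₂ := hz2 b c a hbc hab.ne hac
      have t : ({b, c, a} : Finset V) = {a, b, c} := by ext; simp; tauto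
      simp only [vertexCoeff, t] at e₁ e₂
      rw [hy1 b c hbc] at e₁
      rw [hy1 b a hab.symm, hw, hz1' a b hab] at e₂
      linarith
    -- The pair `y - m z` has zero differential, so its edge values, which are those of `φ - m ψ`,
    -- have no circulation around 4-cycles.
    have hvanish : ∀ s ∈ squareBoundaries G, φ s - m * ψ s = 0 := by
      intro s hs
      induction hs using Submodule.span_induction with
      | mem s hs =>
        obtain ⟨a, b, c, d, hab, hbc, hcd, hda, hac, hbd, rfl⟩ := hs
        have e₁ := hpath a b c hab hbc hac
        have e₂ := hpath c d a hcd hda hac.symm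
        simp only [map_add, hψ' _ _ hab, hψ' _ _ hbc, hψ' _ _ hcd, hψ' _ _ hda]
        simp only [w] at e₁ e₂
        linarith
      | zero => simp
      | add s t _ _ hs ht => rw [map_add, map_add]; linarith
      | smul r s _ hs =>
        rw [map_smul, map_smul, smul_eq_mul, smul_eq_mul]
        linear_combination r * hs
    rcases hm with h | h
    · exact ⟨-ψ, fun s hs => by rw [LinearMap.neg_apply, ← hvanish s hs, h]; ring⟩
    · exact ⟨ψ, fun s hs => by rw [← hvanish s hs, h]; ring⟩

end SquareComplexTorsion

/-! ### Monomial bases of the tensor powers and the merge maps in coordinates. -/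

section Monomials

/-- The monomial basis of `𝒜_m`. -/
def truncBasis (m : ℕ) : Module.Basis (Fin m) ℤ (Trunc m) :=
  (AdjoinRoot.powerBasisAux' (Polynomial.monic_X_pow m)).reindex
    (finCongr (Polynomial.natDegree_X_pow m))

/-- For `k ≥ m` both sides are 0, because the power vanishes and `i < m`. Truncation therefore needs
no separate case when exponents are added. -/
theorem truncBasis_repr_root_pow (m k : ℕ) (i : Fin m) :
    (truncBasis m).repr (AdjoinRoot.root (Polynomial.X ^ m : Polynomial ℤ) ^ k) i =
      if k = i then 1 else 0 := by
  have h : (AdjoinRoot.root (Polynomial.X ^ m : Polynomial ℤ) ^ k) =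
      AdjoinRoot.mk (Polynomial.X ^ m : Polynomial ℤ) (Polynomial.X ^ k) := by
    rw [map_pow, AdjoinRoot.mk_X]
  rw [truncBasis, Module.Basis.repr_reindex_apply, AdjoinRoot.powerBasisAux'_repr_apply_to_fun, h,
    AdjoinRoot.modByMonicHom_mk]
  simp only [finCongr_symm, finCongr_apply, Fin.val_cast]
  by_cases hk : k < m
  · rw [(Polynomial.modByMonic_eq_self_iff (Polynomial.monic_X_pow m)).2 (by simpa using hk),
      Polynomial.coeff_X_pow]
    simp [eq_comm]
  · rw [(Polynomial.modByMonic_eq_zero_iff_dvd (Polynomial.monic_X_pow m)).2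
      (pow_dvd_pow _ (not_lt.1 hk)), if_neg (by omega), Polynomial.coeff_zero]

theorem truncBasis_apply (m : ℕ) (i : Fin m) :
    truncBasis m i = AdjoinRoot.root (Polynomial.X ^ m : Polynomial ℤ) ^ (i : ℕ) := by
  refine (truncBasis m).ext_elem fun k => ?_
  rw [truncBasis_repr_root_pow, Module.Basis.repr_self, Finsupp.single_apply]
  simp [Fin.ext_iff]

/-- The monomial basis of `𝒜_m^{⊗ ι}`. -/
def monomialBasis (m : ℕ) (ι : Type*) [Finite ι] :
    Module.Basis (ι → Fin m) ℤ (⨂[ℤ] _c : ι, Trunc m) :=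
  Basis.piTensorProduct fun _ => truncBasis m

theorem monomialBasis_apply (m : ℕ) {ι : Type*} [Finite ι] (a : ι → Fin m) :
    monomialBasis m ι a = PiTensorProduct.tprod ℤ
      fun c => AdjoinRoot.root (Polynomial.X ^ m : Polynomial ℤ) ^ (a c : ℕ) := by
  simp [monomialBasis, truncBasis_apply]

theorem monomialBasis_repr_merge_basis (m : ℕ) {ι κ : Type*} [Fintype ι] [Fintype κ] (p : ι → κ)
    (a : ι → Fin m) (b : κ → Fin m) :
    (monomialBasis m κ).repr (merge ℤ (Trunc m) p (monomialBasis m ι a)) b =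
      if ∀ k, ∑ c with p c = k, (a c : ℕ) = b k then 1 else 0 := by
  rw [monomialBasis_apply, merge_tprod, monomialBasis, Basis.piTensorProduct_repr_tprod_apply]
  simp only [fibreProd, Finset.prod_pow_eq_pow_sum, truncBasis_repr_root_pow]
  rw [Fintype.prod_ite_zero]
  simp

theorem monomialBasis_repr_merge (m : ℕ) {ι κ : Type*} [Fintype ι] [Fintype κ] (p : ι → κ)
    (z : ⨂[ℤ] _c : ι, Trunc m) (b : κ → Fin m) :
    (monomialBasis m κ).repr (merge ℤ (Trunc m) p z) b =
      ∑ a : ι → Fin m, if ∀ k, ∑ c with p c = k, (a c : ℕ) = b k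
        then (monomialBasis m ι).repr z a else 0 := by
  conv_lhs => rw [← (monomialBasis m ι).sum_repr z]
  simp only [map_sum, map_smul, Finsupp.finsetSum_apply, Finsupp.smul_apply,
    monomialBasis_repr_merge_basis, smul_eq_mul, mul_ite, mul_one, mul_zero]

variable {V : Type*} (G : SimpleGraph V) [Fintype V]

theorem mem_degreePart_iff (m : ℕ) (s : Finset G.edgeSet) (j : ℤ)
    (z : ⨂[ℤ] _c : Component G s, Trunc m) :
    z ∈ degreePart G m s j ↔
      ∀ a, (monomialBasis m (Component G s)).repr z a ≠ 0 → ∑ c, ((a c : ℕ) : ℤ) = j := by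
  have h : {z : ⨂[ℤ] _c : Component G s, Trunc m | ∃ a : Component G s → Fin m,
      (∑ c, ((a c : ℕ) : ℤ)) = j ∧
      z = PiTensorProduct.tprod ℤ fun c => AdjoinRoot.root (Polynomial.X ^ m) ^ (a c : ℕ)} =
      monomialBasis m (Component G s) '' {a | ∑ c, ((a c : ℕ) : ℤ) = j} := by
    ext z
    simp only [Set.mem_ofPred_eq, Set.mem_image, monomialBasis_apply]
    exact exists_congr fun a => and_congr_right fun _ => eq_comm
  rw [degreePart, h, Module.Basis.mem_span_image]
  simp [Set.subset_def]

theorem merge_mem_degreePart (m : ℕ) {s t : Finset G.edgeSet} (h : s ⊆ t) (j : ℤ)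
    {z : ⨂[ℤ] _c : Component G s, Trunc m} (hz : z ∈ degreePart G m s j) :
    merge ℤ (Trunc m) (componentMap G h) z ∈ degreePart G m t j := by
  rw [mem_degreePart_iff] at hz ⊢
  intro b hb
  rw [monomialBasis_repr_merge] at hb
  obtain ⟨a, -, ha⟩ := Finset.exists_ne_zero_of_sum_ne_zero hb
  obtain ⟨ha, hz'⟩ := ite_ne_right_iff.1 ha
  rw [← hz a hz', ← Finset.sum_fiberwise Finset.univ (componentMap G h)]
  refine Finset.sum_congr rfl fun k _ => ?_
  rw [← ha k]
  push_cast
  rfl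

theorem differential_apply (k A : Type*) [CommRing k] [CommRing A] [Algebra k A]
    (ord : LinearOrder G.edgeSet) (f : Cochain G k A) (t : Finset G.edgeSet) :
    differential G k A ord f t = ∑ e ∈ t,
      ((-1 : k) ^ ((t.erase e).filter fun e' => ord.lt e' e).card) •
        merge k A (componentMap G (Finset.erase_subset e t)) (f (t.erase e)) := by
  simp [differential]

theorem differential_mem_cochainPart (m : ℕ) (ord : LinearOrder G.edgeSet) {i j : ℤ}
    {f : Cochain G ℤ (Trunc m)} (hf : f ∈ cochainPart G m i j) :
    differential G ℤ (Trunc m) ord f ∈ cochainPart G m (i + 1) j := by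
  refine ⟨fun t ht => ?_, fun t => ?_⟩
  · rw [differential_apply]
    refine Finset.sum_eq_zero fun e he => ?_
    rw [hf.1 (t.erase e), map_zero, smul_zero]
    have := Finset.card_erase_add_one he
    omega
  · rw [differential_apply]
    exact Submodule.sum_mem _ fun e he =>
      Submodule.smul_mem _ _ (merge_mem_degreePart G m _ j (hf.2 _))

theorem differential_singleton (k A : Type*) [CommRing k] [CommRing A] [Algebra k A]
    (ord : LinearOrder G.edgeSet) (f : Cochain G k A) (e : G.edgeSet) :
    differential G k A ord f {e} =
      merge k A (componentMap G (Finset.empty_subset {e})) (f ∅) := by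
  have h : ∀ (s : Finset G.edgeSet) (hs : s ⊆ {e}), s = ∅ →
      merge k A (componentMap G hs) (f s) =
        merge k A (componentMap G (Finset.empty_subset {e})) (f ∅) := by
    rintro s hs rfl
    rfl
  rw [differential_apply, Finset.sum_singleton, h _ _ (by simp)]
  simp

end Monomials

/-! ### Components of spanning subgraphs with at most two edges. -/

section Components

universe u

variable {V : Type u} (G : SimpleGraph V)

/-- The component of a vertex in `[G:s]`. -/
abbrev componentOf (s : Finset G.edgeSet) (v : V) : Component G s :=
  (spanning G s).connectedComponentMk v

theorem componentOf_surjective (s : Finset G.edgeSet) :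
    Function.Surjective (componentOf G s) :=
  fun κ => κ.exists_rep

theorem componentOf_eq_of_mem {s : Finset G.edgeSet} {a b : V} (h : G.Adj a b)
    (hs : (⟨s(a, b), h⟩ : G.edgeSet) ∈ s) : componentOf G s a = componentOf G s b := by
  refine SimpleGraph.ConnectedComponent.sound (SimpleGraph.Adj.reachable ?_)
  rw [spanning, SimpleGraph.fromEdgeSet_adj]
  exact ⟨⟨_, hs, rfl⟩, h.ne⟩

theorem componentOf_empty_injective : Function.Injective (componentOf G ∅) := by
  intro u v h
  have h' : (spanning G ∅).Reachable u v := SimpleGraph.ConnectedComponent.exact h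
  have hbot : spanning G ∅ = ⊥ := by simp [spanning]
  rw [hbot, SimpleGraph.reachable_bot] at h'
  exact h'

/-- The components of `[G:∅]` are the vertices. -/
def emptyComponentEquiv : V ≃ Component G ∅ :=
  Equiv.ofBijective (componentOf G ∅)
    ⟨componentOf_empty_injective G, componentOf_surjective G ∅⟩

theorem componentOf_singleton_eq_iff {a b : V} (h : G.Adj a b) (u v : V) :
    componentOf G {⟨s(a, b), h⟩} u = componentOf G {⟨s(a, b), h⟩} v ↔
      u = v ∨ s(u, v) = s(a, b) := by
  constructor
  · intro huv
    have hr : (spanning G {⟨s(a, b), h⟩}).Reachable u v := SimpleGraph.ConnectedComponent.exact huv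
    obtain ⟨p⟩ := hr
    induction p with
    | nil => exact Or.inl rfl
    | @cons x y z hxy _ ih =>
      have hxy' : s(x, y) = s(a, b) := by
        rw [spanning, SimpleGraph.fromEdgeSet_adj] at hxy
        obtain ⟨⟨e, he, hes⟩, -⟩ := hxy
        rw [Finset.coe_singleton, Set.mem_singleton_iff] at he
        rw [← hes, he]
      have ih := ih (SimpleGraph.ConnectedComponent.sound ⟨‹_›⟩)
      rcases ih with rfl | ih
      · exact Or.inr hxy'
      · left
        simp only [Sym2.eq_iff] at hxy' ih
        aesop
  · rintro (rfl | huv)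
    · rfl
    · have hab := componentOf_eq_of_mem G h (Finset.mem_singleton_self _)
      rcases Sym2.eq_iff.1 huv with ⟨rfl, rfl⟩ | ⟨rfl, rfl⟩
      · exact hab
      · exact hab.symm

variable [Fintype V]

theorem card_component_singleton (e : G.edgeSet) :
    Fintype.card (Component G {e}) + 1 = Fintype.card V := by
  obtain ⟨e, he⟩ := e
  induction e using Sym2.ind with
  | _ a b =>
  have hab : G.Adj a b := he
  have hbij : Function.Bijective
      (fun v : {v : V // v ≠ b} => componentOf G {⟨s(a, b), he⟩} v) := by
    constructor
    · intro u v huv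
      rcases (componentOf_singleton_eq_iff G hab _ _).1 huv with h | h
      · exact Subtype.ext h
      · rcases Sym2.eq_iff.1 h with ⟨-, h⟩ | ⟨h, -⟩
        · exact absurd h v.2
        · exact absurd h u.2
    · intro κ
      obtain ⟨v, rfl⟩ := componentOf_surjective G _ κ
      by_cases hv : v = b
      · subst hv
        exact ⟨⟨a, hab.ne⟩, componentOf_eq_of_mem G hab (Finset.mem_singleton_self _)⟩
      · exact ⟨⟨v, hv⟩, rfl⟩
  rw [← Fintype.card_of_bijective hbij, Fintype.card_subtype_compl, Fintype.card_subtype_eq]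
  have : 0 < Fintype.card V := Fintype.card_pos_iff.2 ⟨a⟩
  omega

/-- Each of two distinct edges has an endpoint off the other. Both endpoints can be dropped, since
the other end of each edge still represents its component. -/
theorem card_component_add_two_le {t : Finset G.edgeSet} (ht : t.card = 2) :
    Fintype.card (Component G t) + 2 ≤ Fintype.card V := by
  obtain ⟨⟨e, he⟩, ⟨e', he'⟩, hne, rfl⟩ := Finset.card_eq_two.1 ht
  obtain ⟨a, b, rfl, hb⟩ : ∃ a b, e = s(a, b) ∧ b ∉ e' := by
    induction e using Sym2.ind with
    | _ a b =>
    by_contra! h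
    have hb := h a b rfl
    have ha := h b a Sym2.eq_swap
    have hab : a ≠ b := G.ne_of_adj he
    exact hne (Subtype.ext ((Sym2.mem_and_mem_iff hab).1 ⟨ha, hb⟩).symm)
  obtain ⟨c, d, rfl, hd⟩ : ∃ c d, e' = s(c, d) ∧ d ∉ s(a, b) := by
    induction e' using Sym2.ind with
    | _ c d =>
    by_contra! h
    have hd := h c d rfl
    have hc := h d c Sym2.eq_swap
    have hcd : c ≠ d := G.ne_of_adj he'
    exact hne (Subtype.ext ((Sym2.mem_and_mem_iff hcd).1 ⟨hc, hd⟩))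
  simp only [Sym2.mem_iff, not_or] at hb hd
  have hab : G.Adj a b := he
  have hcd : G.Adj c d := he'
  have hsurj : Function.Surjective (fun v : {v : V // v ∉ ({b, d} : Finset V)} =>
      componentOf G {⟨s(a, b), he⟩, ⟨s(c, d), he'⟩} v) := by
    intro κ
    obtain ⟨v, rfl⟩ := componentOf_surjective G _ κ
    by_cases hv : v = b
    · subst hv
      exact ⟨⟨a, by simp [hab.ne, Ne.symm hd.1]⟩, componentOf_eq_of_mem G hab (by simp)⟩
    · by_cases hv' : v = d
      · subst hv'
        exact ⟨⟨c, by simp [hcd.ne, Ne.symm hb.1]⟩, componentOf_eq_of_mem G hcd (by simp)⟩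
      · exact ⟨⟨v, by simp [hv, hv']⟩, rfl⟩
  have h1 := Fintype.card_le_of_surjective _ hsurj
  rw [Fintype.card_subtype_compl, Fintype.card_coe, Finset.card_pair hb.2] at h1
  have h2 := Finset.card_le_univ ({b, d} : Finset V)
  rw [Finset.card_pair hb.2] at h2
  omega

end Components

/-! ### Exponent vectors of deficit 3 on the vertices. -/

section ExponentVectors

variable {V : Type*}

/-- Exponent `0` at `a`, `1` at `b` and `2` elsewhere. -/
def pairExponent (a b : V) : V → Fin 3 := fun v => if v = a then 0 else if v = b then 1 else 2

/-- Exponent `1` on `T` and `2` elsewhere. -/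
def setExponent (T : Finset V) : V → Fin 3 := fun v => if v ∈ T then 1 else 2

theorem pairExponent_injective {a b a' b' : V} (hab : a ≠ b)
    (h : pairExponent a b = pairExponent a' b') : a = a' ∧ b = b' := by
  have ha := congrFun h a
  have hb := congrFun h b
  simp only [pairExponent] at ha hb
  by_cases h1 : a = a'
  · refine ⟨h1, ?_⟩
    subst h1
    by_contra h2
    simp [hab.symm, h2] at hb
  · rw [if_pos trivial, if_neg h1] at ha
    split_ifs at ha <;> simp at ha

theorem pairExponent_ne_setExponent (a b : V) (T : Finset V) :
    pairExponent a b ≠ setExponent T := by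
  intro h
  have := congrFun h a
  by_cases ha : a ∈ T <;> simp [pairExponent, setExponent, ha] at this

theorem setExponent_injective {T T' : Finset V} (h : setExponent T = setExponent T') :
    T = T' := by
  ext v
  have := congrFun h v
  by_cases h1 : v ∈ T <;> by_cases h2 : v ∈ T' <;> simp_all [setExponent]

/-- The exponents at `a` and `b` sum to 2 as 0 + 2, 2 + 0 or 1 + 1; these are the three terms of
`vertexCoeff`. -/
theorem eq_exponent_iff_of_ne {a b c : V} (hab : a ≠ b) (hca : c ≠ a) (hcb : c ≠ b)
    (m : V → Fin 3) :
    ((m a : ℕ) + m b = 2 ∧ ∀ v, v ≠ a → v ≠ b → m v = if v = c then 1 else 2) ↔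
      m = pairExponent a c ∨ m = pairExponent b c ∨ m = setExponent {a, b, c} := by
  constructor
  · rintro ⟨h, hm⟩
    have hm' : ∀ f : V → Fin 3, f a = m a → f b = m b →
        (∀ v, v ≠ a → v ≠ b → f v = if v = c then 1 else 2) → m = f := by
      intro f ha hb hv
      funext v
      by_cases h1 : v = a
      · rw [h1, ha]
      · by_cases h2 : v = b
        · rw [h2, hb]
        · rw [hm v h1 h2, hv v h1 h2]
    have cases : (m a = 0 ∧ m b = 2) ∨ (m a = 2 ∧ m b = 0) ∨ (m a = 1 ∧ m b = 1) := by
      generalize m a = x at h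
      generalize m b = y at h
      revert x y
      decide
    rcases cases with ⟨ha, hb⟩ | ⟨ha, hb⟩ | ⟨ha, hb⟩
    · left
      apply hm'
      · simp [pairExponent, ha]
      · simp [pairExponent, hb, hab.symm, hcb.symm]
      · intro v h1 h2
        simp [pairExponent, h1]
    · right; left
      apply hm'
      · simp [pairExponent, ha, hab, hca.symm]
      · simp [pairExponent, hb]
      · intro v h1 h2
        simp [pairExponent, h2]
    · right; right
      apply hm'
      · simp [setExponent, ha]
      · simp [setExponent, hb]
      · intro v h1 h2
        simp [setExponent, h1, h2]
  · rintro (rfl | rfl | rfl)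
    · exact ⟨by simp [pairExponent, hab.symm, hcb.symm], fun v h1 h2 => by simp [pairExponent, h1]⟩
    · exact ⟨by simp [pairExponent, hab, hca.symm], fun v h1 h2 => by simp [pairExponent, h2]⟩
    · exact ⟨by simp [setExponent], fun v h1 h2 => by simp [setExponent, h1, h2]⟩

theorem eq_exponent_iff_of_eq {a b : V} (hab : a ≠ b) (m : V → Fin 3) :
    ((m a : ℕ) + m b = 1 ∧ ∀ v, v ≠ a → v ≠ b → m v = 2) ↔
      m = pairExponent a b ∨ m = pairExponent b a := by
  constructor
  · rintro ⟨h, hm⟩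
    have hm' : ∀ f : V → Fin 3, f a = m a → f b = m b →
        (∀ v, v ≠ a → v ≠ b → f v = 2) → m = f := by
      intro f ha hb hv
      funext v
      by_cases h1 : v = a
      · rw [h1, ha]
      · by_cases h2 : v = b
        · rw [h2, hb]
        · rw [hm v h1 h2, hv v h1 h2]
    have cases : (m a = 0 ∧ m b = 1) ∨ (m a = 1 ∧ m b = 0) := by
      generalize m a = x at h
      generalize m b = y at h
      revert x y
      decide
    rcases cases with ⟨ha, hb⟩ | ⟨ha, hb⟩
    · left
      apply hm'
      · simp [pairExponent, ha]
      · simp [pairExponent, hb, hab.symm]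
      · intro v h1 h2
        simp [pairExponent, h1, h2]
    · right
      apply hm'
      · simp [pairExponent, ha, hab]
      · simp [pairExponent, hb]
      · intro v h1 h2
        simp [pairExponent, h1, h2]
  · rintro (rfl | rfl)
    · exact ⟨by simp [pairExponent, hab.symm], fun v h1 h2 => by simp [pairExponent, h1, h2]⟩
    · exact ⟨by simp [pairExponent, hab], fun v h1 h2 => by simp [pairExponent, h1, h2]⟩

variable [Fintype V]

theorem sum_pairExponent {a b : V} (hab : a ≠ b) :
    ∑ v, ((pairExponent a b v : ℕ) : ℤ) = 2 * (Fintype.card V : ℤ) - 3 := by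
  have h : ∀ v, ((pairExponent a b v : ℕ) : ℤ) =
      2 - (if v = a then 2 else 0) - (if v = b then 1 else 0) := by
    intro v
    by_cases h1 : v = a
    · subst h1; simp [pairExponent, hab]
    · by_cases h2 : v = b
      · subst h2; simp [pairExponent, h1]
      · simp [pairExponent, h1, h2]
  simp only [h, Finset.sum_sub_distrib, Finset.sum_ite_eq', Finset.mem_univ, if_true,
    Finset.sum_const, Finset.card_univ, nsmul_eq_mul]
  ring

theorem sum_setExponent (T : Finset V) :
    ∑ v, ((setExponent T v : ℕ) : ℤ) = 2 * (Fintype.card V : ℤ) - T.card := by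
  have h : ∀ v, ((setExponent T v : ℕ) : ℤ) = 2 - (if v ∈ T then 1 else 0) := by
    intro v
    by_cases h1 : v ∈ T <;> simp [setExponent, h1]
  simp only [h, Finset.sum_sub_distrib, Finset.sum_const, Finset.card_univ, nsmul_eq_mul,
    Finset.sum_boole, Finset.filter_mem_eq_inter, Finset.univ_inter]
  ring

end ExponentVectors

/-! ### Degree `2v - 3` of the complex in coordinates. -/

section TopDegree

universe u

variable {V : Type u} [Fintype V] (G : SimpleGraph V)

/-- Exponent `1` at `κ` and `2` elsewhere. -/
def topExponent {ι : Type*} (κ : ι) : ι → Fin 3 := fun κ' => if κ' = κ then 1 else 2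

/-- The coefficient of a cochain at the state `{e}` and the monomial with exponent `1` at the
component of `c` and `2` elsewhere. -/
def edgeCoord (f : Cochain G ℤ (Trunc 3)) (e : G.edgeSet) (c : V) : ℤ :=
  (monomialBasis 3 (Component G {e})).repr (f {e}) (topExponent (componentOf G {e} c))

/-- The coefficient of a cochain at the empty state and a monomial in the vertices. -/
def vertexCoord (f : Cochain G ℤ (Trunc 3)) (m : V → Fin 3) : ℤ :=
  (monomialBasis 3 (Component G ∅)).repr (f ∅) (m ∘ (emptyComponentEquiv G).symm)

variable {G}

theorem edgeCoord_differential (ord : LinearOrder G.edgeSet) (g : Cochain G ℤ (Trunc 3)) {a b : V}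
    (h : G.Adj a b) (c : V) :
    edgeCoord G (differential G ℤ (Trunc 3) ord g) ⟨s(a, b), h⟩ c =
      ∑ m : V → Fin 3,
        if (m a : ℕ) + m b = (topExponent (componentOf G {⟨s(a, b), h⟩} c)
            (componentOf G {⟨s(a, b), h⟩} a) : ℕ) ∧
          ∀ v, v ≠ a → v ≠ b → m v = if v = c then 1 else 2
        then vertexCoord G g m else 0 := by
  set e : G.edgeSet := ⟨s(a, b), h⟩ with he
  have key : ∀ u v, componentOf G {e} u = componentOf G {e} v ↔ u = v ∨ s(u, v) = s(a, b) :=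
    componentOf_singleton_eq_iff G h
  rw [edgeCoord, differential_singleton, monomialBasis_repr_merge]
  rw [← ((emptyComponentEquiv G).arrowCongr (Equiv.refl (Fin 3))).sum_comp]
  refine Finset.sum_congr rfl fun m _ => ?_
  have hrw : ((emptyComponentEquiv G).arrowCongr (Equiv.refl (Fin 3))) m =
      m ∘ (emptyComponentEquiv G).symm := rfl
  have hsum : ∀ k, ∑ x with componentMap G (Finset.empty_subset {e}) x = k,
      ((m ∘ (emptyComponentEquiv G).symm) x : ℕ) =
        ∑ v with componentOf G {e} v = k, (m v : ℕ) := by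
    intro k
    rw [Finset.sum_filter, Finset.sum_filter, ← (emptyComponentEquiv G).sum_comp]
    refine Finset.sum_congr rfl fun v _ => ?_
    rw [Function.comp_apply, Equiv.symm_apply_apply]
    rfl
  rw [hrw]
  simp only [hsum]
  refine if_congr ?_ rfl rfl
  have hfa : (Finset.univ.filter fun v => componentOf G {e} v = componentOf G {e} a) = {a, b} := by
    ext v
    simp only [Finset.mem_filter, Finset.mem_univ, true_and, key, Finset.mem_insert,
      Finset.mem_singleton, Sym2.eq_iff]
    have := h.ne
    tauto
  have hfv : ∀ u, u ≠ a → u ≠ b →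
      (Finset.univ.filter fun v => componentOf G {e} v = componentOf G {e} u) = {u} := by
    intro u hua hub
    ext v
    simp only [Finset.mem_filter, Finset.mem_univ, true_and, key, Finset.mem_singleton, Sym2.eq_iff]
    tauto
  have hsuma : ∑ v with componentOf G {e} v = componentOf G {e} a, (m v : ℕ) = m a + m b := by
    rw [hfa, Finset.sum_pair h.ne]
  have htop : ∀ u, u ≠ a → u ≠ b →
      topExponent (componentOf G {e} c) (componentOf G {e} u) = if u = c then 1 else 2 := by
    intro u hua hub
    simp only [topExponent, key, Sym2.eq_iff]
    refine if_congr ?_ rfl rfl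
    tauto
  constructor
  · intro hk
    refine ⟨by rw [← hk, hsuma], fun v hva hvb => ?_⟩
    have := hk (componentOf G {e} v)
    rw [hfv v hva hvb, Finset.sum_singleton, htop v hva hvb] at this
    exact Fin.ext this
  · rintro ⟨h1, h2⟩ κ
    obtain ⟨v, rfl⟩ := componentOf_surjective G _ κ
    by_cases hva : v = a
    · rw [hva, hsuma, h1]
    · by_cases hvb : v = b
      · rw [hvb, ← componentOf_eq_of_mem G h (Finset.mem_singleton_self _), hsuma, h1]
      · rw [hfv v hva hvb, Finset.sum_singleton, htop v hva hvb, h2 v hva hvb]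

theorem edgeCoord_differential_of_ne (ord : LinearOrder G.edgeSet) (g : Cochain G ℤ (Trunc 3))
    {a b c : V} (h : G.Adj a b) (hca : c ≠ a) (hcb : c ≠ b) :
    edgeCoord G (differential G ℤ (Trunc 3) ord g) ⟨s(a, b), h⟩ c =
      vertexCoeff (fun p q => vertexCoord G g (pairExponent p q))
        (fun T => vertexCoord G g (setExponent T)) a b c := by
  have htop : topExponent (componentOf G {⟨s(a, b), h⟩} c)
      (componentOf G {⟨s(a, b), h⟩} a) = 2 := by
    rw [topExponent, if_neg]
    rw [componentOf_singleton_eq_iff G h, Sym2.eq_iff]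
    tauto
  have hne1 : pairExponent a c ≠ pairExponent b c := fun hh =>
    h.ne (pairExponent_injective hca.symm hh).1
  rw [edgeCoord_differential, htop, ← Finset.sum_filter,
    show (Finset.univ.filter fun m : V → Fin 3 => (m a : ℕ) + m b = ((2 : Fin 3) : ℕ) ∧
      ∀ v, v ≠ a → v ≠ b → m v = if v = c then 1 else 2) =
      {pairExponent a c, pairExponent b c, setExponent {a, b, c}} by
        ext m
        simpa using eq_exponent_iff_of_ne h.ne hca hcb m,
    Finset.sum_insert (by simp [hne1, pairExponent_ne_setExponent]),
    Finset.sum_insert (by simp [pairExponent_ne_setExponent]), Finset.sum_singleton, vertexCoeff]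
  ring

theorem edgeCoord_differential_left (ord : LinearOrder G.edgeSet) (g : Cochain G ℤ (Trunc 3))
    {a b : V} (h : G.Adj a b) :
    edgeCoord G (differential G ℤ (Trunc 3) ord g) ⟨s(a, b), h⟩ a =
      vertexCoord G g (pairExponent a b) + vertexCoord G g (pairExponent b a) := by
  have htop : topExponent (componentOf G {⟨s(a, b), h⟩} a)
      (componentOf G {⟨s(a, b), h⟩} a) = 1 := if_pos rfl
  have hne1 : pairExponent a b ≠ pairExponent b a := fun hh =>
    h.ne (pairExponent_injective h.ne hh).1
  rw [edgeCoord_differential, htop, ← Finset.sum_filter,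
    show (Finset.univ.filter fun m : V → Fin 3 => (m a : ℕ) + m b = ((1 : Fin 3) : ℕ) ∧
      ∀ v, v ≠ a → v ≠ b → m v = if v = a then 1 else 2) =
      {pairExponent a b, pairExponent b a} by
        ext m
        simp only [Finset.mem_filter, Finset.mem_univ, true_and, Finset.mem_insert,
          Finset.mem_singleton, ← eq_exponent_iff_of_eq h.ne m]
        refine and_congr Iff.rfl (forall_congr' fun v => forall_congr' fun hv => ?_)
        rw [if_neg hv],
    Finset.sum_pair hne1]

/-- Coefficients of a vertex cochain can be prescribed. -/
theorem exists_vertexCochain (y₁ : V → V → ℤ) (y₂ : Finset V → ℤ) :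
    ∃ g ∈ cochainPart G 3 0 (2 * (Fintype.card V : ℤ) - 3),
      (∀ a b, a ≠ b → vertexCoord G g (pairExponent a b) = y₁ a b) ∧
      ∀ T : Finset V, T.card = 3 → vertexCoord G g (setExponent T) = y₂ T := by
  let y : (V → Fin 3) → ℤ := fun m =>
    if h : ∃ p : V × V, p.1 ≠ p.2 ∧ m = pairExponent p.1 p.2 then y₁ h.choose.1 h.choose.2
    else if h : ∃ T, m = setExponent T then y₂ h.choose else 0
  have hy₁ : ∀ a b, a ≠ b → y (pairExponent a b) = y₁ a b := by
    intro a b hab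
    have h : ∃ p : V × V, p.1 ≠ p.2 ∧ pairExponent a b = pairExponent p.1 p.2 := ⟨(a, b), hab, rfl⟩
    have e : y (pairExponent a b) = y₁ h.choose.1 h.choose.2 := dif_pos h
    obtain ⟨h1, h2⟩ := pairExponent_injective hab h.choose_spec.2
    rw [e, ← h1, ← h2]
  have hy₂ : ∀ T, y (setExponent T) = y₂ T := by
    intro T
    have h : ¬ ∃ p : V × V, p.1 ≠ p.2 ∧ setExponent T = pairExponent p.1 p.2 := by
      rintro ⟨p, -, hp⟩
      exact pairExponent_ne_setExponent _ _ _ hp.symm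
    have h' : ∃ T', setExponent T = setExponent T' := ⟨T, rfl⟩
    have e : y (setExponent T) = y₂ h'.choose := by
      simp only [y, dif_neg h, dif_pos h']
    rw [e, ← setExponent_injective h'.choose_spec]
  let φ := emptyComponentEquiv G
  -- The cutoff enforces homogeneity: `setExponent T` has degree `2v - |T|`, so only triples
  -- survive.
  let z : ⨂[ℤ] _c : Component G ∅, Trunc 3 := (monomialBasis 3 (Component G ∅)).equivFun.symm
    fun a => if ∑ c, ((a c : ℕ) : ℤ) = 2 * (Fintype.card V : ℤ) - 3 then y (a ∘ φ) else 0
  have hz : ∀ a, (monomialBasis 3 (Component G ∅)).repr z a =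
      if ∑ c, ((a c : ℕ) : ℤ) = 2 * (Fintype.card V : ℤ) - 3 then y (a ∘ φ) else 0 := by
    intro a
    rw [← Module.Basis.equivFun_apply, LinearEquiv.apply_symm_apply]
  let g : Cochain G ℤ (Trunc 3) := Pi.single ∅ z
  have hg : ∀ m : V → Fin 3, ∑ v, ((m v : ℕ) : ℤ) = 2 * (Fintype.card V : ℤ) - 3 →
      vertexCoord G g m = y m := by
    intro m hm
    have hm' : ∑ c, (((m ∘ φ.symm) c : ℕ) : ℤ) = 2 * (Fintype.card V : ℤ) - 3 := by
      rw [← hm, ← φ.symm.sum_comp fun v => ((m v : ℕ) : ℤ)]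
      rfl
    rw [vertexCoord, show g ∅ = z from Pi.single_eq_same _ _]
    refine (hz _).trans ?_
    rw [if_pos hm', Function.comp_assoc, Equiv.symm_comp_self, Function.comp_id]
  refine ⟨g, ⟨fun s hs => ?_, fun s => ?_⟩, fun a b hab => ?_, fun T hT => ?_⟩
  · refine Pi.single_eq_of_ne ?_ _
    rintro rfl
    exact hs rfl
  · by_cases hs : s = ∅
    · subst hs
      rw [show g ∅ = z from Pi.single_eq_same _ _, mem_degreePart_iff]
      intro a ha
      rw [hz] at ha
      exact (ite_ne_right_iff.1 ha).1
    · rw [show g s = 0 from Pi.single_eq_of_ne hs _]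
      exact zero_mem _
  · rw [hg _ (sum_pairExponent hab), hy₁ a b hab]
  · rw [hg _ (by rw [sum_setExponent, hT]; rfl), hy₂]

/-- The monomials in the components of `[G:e]` of degree `2v - 3` are those with one exponent `1`. -/
theorem exists_eq_topExponent (e : G.edgeSet) (a : Component G {e} → Fin 3)
    (ha : ∑ c, ((a c : ℕ) : ℤ) = 2 * (Fintype.card V : ℤ) - 3) :
    ∃ c, a = topExponent (componentOf G {e} c) := by
  have hcard := card_component_singleton G e
  -- With `v - 1` components the top degree is `2v - 2`, so the total deficit is 1 and sits at a
  -- single component.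
  have hsum : ∑ c, (2 - (a c : ℕ)) = 1 := by
    have h : ((∑ c, (2 - (a c : ℕ)) : ℕ) : ℤ) = 1 := by
      rw [Nat.cast_sum, Finset.sum_congr rfl fun c _ => Nat.cast_sub (Fin.is_le (a c)),
        Finset.sum_sub_distrib, ha, Finset.sum_const, Finset.card_univ, ← hcard]
      simp only [nsmul_eq_mul]
      push_cast
      ring
    exact_mod_cast h
  obtain ⟨κ, hκ⟩ : ∃ κ, 2 - (a κ : ℕ) ≠ 0 := by
    by_contra! h
    simp [h] at hsum
  obtain ⟨c, rfl⟩ := componentOf_surjective G _ κ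
  refine ⟨c, funext fun κ => ?_⟩
  rw [← Finset.add_sum_erase _ _ (Finset.mem_univ (componentOf G {e} c))] at hsum
  have h0 := Finset.sum_eq_zero_iff.1
    (show ∑ x ∈ Finset.univ.erase (componentOf G {e} c), (2 - (a x : ℕ)) = 0 by omega)
  by_cases h : κ = componentOf G {e} c
  · subst h
    rw [topExponent, if_pos rfl]
    apply Fin.ext
    simp only [Fin.val_one]
    omega
  · have := h0 κ (Finset.mem_erase.2 ⟨h, Finset.mem_univ _⟩)
    rw [topExponent, if_neg h]
    apply Fin.ext
    have := (a κ).is_le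
    simp only [Fin.val_two]
    omega

theorem repr_eq_edgeCoord_or_eq_zero {h : Cochain G ℤ (Trunc 3)}
    (hh : h ∈ cochainPart G 3 1 (2 * (Fintype.card V : ℤ) - 3)) (s : Finset G.edgeSet)
    (b : Component G s → Fin 3) :
    (monomialBasis 3 (Component G s)).repr (h s) b = 0 ∨
      ∃ e c, (monomialBasis 3 (Component G s)).repr (h s) b = edgeCoord G h e c := by
  by_cases hs : s.card = 1
  · obtain ⟨e, rfl⟩ := Finset.card_eq_one.1 hs
    by_cases hb : (monomialBasis 3 (Component G {e})).repr (h {e}) b = 0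
    · exact Or.inl hb
    · obtain ⟨c, rfl⟩ := exists_eq_topExponent e b ((mem_degreePart_iff G 3 _ _ _).1 (hh.2 {e}) b hb)
      exact Or.inr ⟨e, c, rfl⟩
  · left
    rw [hh.1 s (by exact_mod_cast hs)]
    simp

theorem eq_zero_of_edgeCoord_eq_zero {h : Cochain G ℤ (Trunc 3)}
    (hh : h ∈ cochainPart G 3 1 (2 * (Fintype.card V : ℤ) - 3))
    (h0 : ∀ e c, edgeCoord G h e c = 0) : h = 0 := by
  funext s
  refine (monomialBasis 3 (Component G s)).ext_elem fun b => ?_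
  rw [Pi.zero_apply, map_zero, Finsupp.zero_apply]
  rcases repr_eq_edgeCoord_or_eq_zero hh s b with h' | ⟨e, c, h'⟩
  · exact h'
  · rw [h', h0]

theorem exists_smul_eq_of_dvd_edgeCoord {h : Cochain G ℤ (Trunc 3)}
    (hh : h ∈ cochainPart G 3 1 (2 * (Fintype.card V : ℤ) - 3)) (n : ℤ)
    (hn : ∀ e c, n ∣ edgeCoord G h e c) :
    ∃ f ∈ cochainPart G 3 1 (2 * (Fintype.card V : ℤ) - 3), n • f = h := by
  have hdvd : ∀ s b, n ∣ (monomialBasis 3 (Component G s)).repr (h s) b := by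
    intro s b
    rcases repr_eq_edgeCoord_or_eq_zero hh s b with h' | ⟨e, c, h'⟩
    · rw [h']; exact dvd_zero n
    · rw [h']; exact hn e c
  let f : Cochain G ℤ (Trunc 3) := fun s => (monomialBasis 3 (Component G s)).equivFun.symm
    fun b => (monomialBasis 3 (Component G s)).repr (h s) b / n
  have hf : ∀ s b, (monomialBasis 3 (Component G s)).repr (f s) b =
      (monomialBasis 3 (Component G s)).repr (h s) b / n := by
    intro s b
    rw [← Module.Basis.equivFun_apply, LinearEquiv.apply_symm_apply]
  refine ⟨f, ⟨fun s hs => ?_, fun s => ?_⟩, ?_⟩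
  · refine (monomialBasis 3 (Component G s)).ext_elem fun b => ?_
    rw [hf, hh.1 s hs]
    simp
  · rw [mem_degreePart_iff]
    intro b hb
    refine (mem_degreePart_iff G 3 _ _ _).1 (hh.2 s) b fun h0 => hb ?_
    rw [hf, h0, Int.zero_ediv]
  · funext s
    refine (monomialBasis 3 (Component G s)).ext_elem fun b => ?_
    rw [Pi.smul_apply, map_smul, Finsupp.smul_apply, hf, smul_eq_mul, Int.mul_ediv_cancel' (hdvd s b)]

/-- The target vanishes: with at most `v - 2` components the degree is at most `2v - 4`. -/
theorem differential_eq_zero_of_mem (ord : LinearOrder G.edgeSet) {f : Cochain G ℤ (Trunc 3)}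
    (hf : f ∈ cochainPart G 3 1 (2 * (Fintype.card V : ℤ) - 3)) :
    differential G ℤ (Trunc 3) ord f = 0 := by
  have hd := differential_mem_cochainPart G 3 ord hf
  funext t
  by_cases ht : t.card = 2
  · refine (monomialBasis 3 (Component G t)).ext_elem fun b => ?_
    rw [Pi.zero_apply, map_zero, Finsupp.zero_apply]
    by_contra hb
    have hsum := (mem_degreePart_iff G 3 _ _ _).1 (hd.2 t) b hb
    have hle : ∑ c, ((b c : ℕ) : ℤ) ≤ ∑ _c : Component G t, 2 :=
      Finset.sum_le_sum fun c _ => by exact_mod_cast (b c).is_le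
    rw [hsum, Finset.sum_const, Finset.card_univ, nsmul_eq_mul] at hle
    have := card_component_add_two_le G ht
    omega
  · exact hd.1 t (by norm_num; exact_mod_cast ht)

theorem cocycles_eq (ord : LinearOrder G.edgeSet) :
    cocycles G 3 ord 1 (2 * (Fintype.card V : ℤ) - 3) =
      cochainPart G 3 1 (2 * (Fintype.card V : ℤ) - 3) :=
  inf_eq_left.2 fun _ hf => differential_eq_zero_of_mem ord hf

theorem saturated_coboundaries_iff (ord : LinearOrder G.edgeSet) {n : ℕ} (hn : 0 < n) :
    (∀ f ∈ cocycles G 3 ord 1 (2 * (Fintype.card V : ℤ) - 3),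
      n • f ∈ coboundaries G 3 ord 1 (2 * (Fintype.card V : ℤ) - 3) →
        f ∈ coboundaries G 3 ord 1 (2 * (Fintype.card V : ℤ) - 3)) ↔ SaturatedAt G n := by
  have hn' : (n : ℤ) ≠ 0 := by exact_mod_cast hn.ne'
  have hsmul : ∀ (f : Cochain G ℤ (Trunc 3)) e c,
      edgeCoord G ((n : ℤ) • f) e c = n * edgeCoord G f e c := by
    intro f e c
    simp only [edgeCoord, Pi.smul_apply, map_smul, Finsupp.smul_apply, smul_eq_mul]
  have hcard : ∀ a b c : V, G.Adj a b → c ≠ a → c ≠ b → ({a, b, c} : Finset V).card = 3 :=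
    fun a b c hab hca hcb => Finset.card_eq_three.2 ⟨a, b, c, hab.ne, hca.symm, hcb.symm, rfl⟩
  -- The two ends of an edge index the same coordinate, so one end suffices after swapping the edge.
  have hedges : ∀ P : G.edgeSet → V → Prop,
      (∀ a b (h : G.Adj a b) c, c ≠ a → c ≠ b → P ⟨s(a, b), h⟩ c) →
      (∀ a b (h : G.Adj a b), P ⟨s(a, b), h⟩ a) →
      ∀ e c, P e c := by
    intro P h1 h2 ⟨e, he⟩ c
    induction e using Sym2.ind with
    | _ a b =>
    by_cases hca : c = a
    · subst hca
      exact h2 _ _ he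
    · by_cases hcb : c = b
      · subst hcb
        have := h2 c a (G.adj_symm he)
        simpa only [Sym2.eq_swap (a := c)] using this
      · exact h1 a b he c hca hcb
  rw [cocycles_eq, coboundaries, sub_self]
  constructor
  · intro hS y₁ y₂ h₂ h₁
    obtain ⟨g, hg, hg₁, hg₂⟩ := exists_vertexCochain (G := G) y₁ y₂
    have e₂ : ∀ a b c (h : G.Adj a b), c ≠ a → c ≠ b →
        edgeCoord G (differential G ℤ (Trunc 3) ord g) ⟨s(a, b), h⟩ c =
          vertexCoeff y₁ y₂ a b c := by
      intro a b c h hca hcb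
      rw [edgeCoord_differential_of_ne ord g h hca hcb]
      simp only [vertexCoeff]
      rw [hg₁ a c hca.symm, hg₁ b c hcb.symm, hg₂ _ (hcard a b c h hca hcb)]
    have e₁ : ∀ a b (h : G.Adj a b),
        edgeCoord G (differential G ℤ (Trunc 3) ord g) ⟨s(a, b), h⟩ a = y₁ a b + y₁ b a := by
      intro a b h
      rw [edgeCoord_differential_left ord g h, hg₁ a b h.ne, hg₁ b a h.ne']
    obtain ⟨f, hf, hnf⟩ := exists_smul_eq_of_dvd_edgeCoord
      (differential_mem_cochainPart G 3 ord hg) n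
      (hedges _ (fun a b h c hca hcb => by
        rw [e₂ a b c h hca hcb]; exact h₂ a b c h hca hcb) fun a b h => by
        rw [e₁ a b h]; exact h₁ a b h)
    obtain ⟨g', -, hg'⟩ := hS f hf ⟨g, hg, by rw [← hnf, natCast_zsmul]⟩
    refine ⟨fun p q => vertexCoord G g' (pairExponent p q),
      fun T => vertexCoord G g' (setExponent T), fun a b c h hca hcb => ?_, fun a b h => ?_⟩
    · rw [← e₂ a b c h hca hcb, ← edgeCoord_differential_of_ne ord g' h hca hcb, hg', ← hnf, hsmul]
    · rw [← e₁ a b h, ← edgeCoord_differential_left ord g' h, hg', ← hnf, hsmul]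
  · rintro hA f hf ⟨g, hg, hgf⟩
    rw [← natCast_zsmul] at hgf
    obtain ⟨z₁, z₂, hz₂, hz₁⟩ := hA (fun p q => vertexCoord G g (pairExponent p q))
      (fun T => vertexCoord G g (setExponent T))
      (fun a b c h hca hcb => by
        rw [← edgeCoord_differential_of_ne ord g h hca hcb, hgf, hsmul]
        exact dvd_mul_right _ _)
      (fun a b h => by
        rw [← edgeCoord_differential_left ord g h, hgf, hsmul]
        exact dvd_mul_right _ _)
    obtain ⟨g', hg', hg₁, hg₂⟩ := exists_vertexCochain (G := G) z₁ z₂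
    refine ⟨g', hg', ?_⟩
    rw [← sub_eq_zero]
    refine eq_zero_of_edgeCoord_eq_zero
      (sub_mem (differential_mem_cochainPart G 3 ord hg') hf) ?_
    have hsub : ∀ (f f' : Cochain G ℤ (Trunc 3)) e c,
        edgeCoord G (f - f') e c = edgeCoord G f e c - edgeCoord G f' e c := by
      intro f f' e c
      simp only [edgeCoord, Pi.sub_apply, map_sub, Finsupp.sub_apply]
    refine hedges _ (fun a b h c hca hcb => ?_) fun a b h => ?_
    · rw [hsub, sub_eq_zero]
      refine mul_left_cancel₀ hn' ?_
      rw [← hsmul f, ← hgf, edgeCoord_differential_of_ne ord g h hca hcb, hz₂ a b c h hca hcb,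
        edgeCoord_differential_of_ne ord g' h hca hcb]
      simp only [vertexCoeff]
      rw [hg₁ a c hca.symm, hg₁ b c hcb.symm, hg₂ _ (hcard a b c h hca hcb)]
    · rw [hsub, sub_eq_zero]
      refine mul_left_cancel₀ hn' ?_
      rw [← hsmul f, ← hgf, edgeCoord_differential_left ord g h, hz₁ a b h,
        edgeCoord_differential_left ord g' h, hg₁ a b h.ne, hg₁ b a h.ne']

end TopDegree

end ChromaticGraphCohomology

end

/-! ### The two assertions, read off from `SaturatedAt`. -/

theorem corollary4p10 {V : Type*} [Fintype V] (G : SimpleGraph V) (ord : LinearOrder G.edgeSet) :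
    ((∃ a b c : V, G.Adj a b ∧ G.Adj b c ∧ G.Adj c a) →
      ∃ φ : ZMod 3 →+
          ChromaticGraphCohomology.Cohomology G 3 ord 1 (2 * (Fintype.card V : ℤ) - 3),
        Function.Injective φ) ∧
    (AddCommGroup.torsion
          (ChromaticGraphCohomology.Cohomology G 3 ord 1 (2 * (Fintype.card V : ℤ) - 3)) ≠ ⊥ ↔
      (∃ a b c : V, G.Adj a b ∧ G.Adj b c ∧ G.Adj c a) ∨
        AddCommGroup.torsion (ChromaticGraphCohomology.SquareH1 G) ≠ ⊥) := by
  have htor : AddCommGroup.torsion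
      (ChromaticGraphCohomology.Cohomology G 3 ord 1 (2 * (Fintype.card V : ℤ) - 3)) = ⊥ ↔
        ∀ n : ℕ, 0 < n → ChromaticGraphCohomology.SaturatedAt G n := by
    rw [ChromaticGraphCohomology.torsion_quotient_eq_bot_iff]
    exact forall_congr' fun n => forall_congr' fun hn =>
      ChromaticGraphCohomology.saturated_coboundaries_iff ord hn
  refine ⟨?_, ?_⟩
  · rintro ⟨a, b, c, hab, hbc, hca⟩
    have h3 := ChromaticGraphCohomology.not_saturatedAt_three_of_triangle G hab hbc hca
    rw [← Nat.cast_ofNat (R := ℤ) (n := 3),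
      ← ChromaticGraphCohomology.saturated_coboundaries_iff ord (by norm_num)] at h3
    push Not at h3
    obtain ⟨f, hf, h3f, hfn⟩ := h3
    exact ChromaticGraphCohomology.exists_zmod_embedding 3 _ _ hf h3f hfn
  · by_cases hG : ∃ a b c : V, G.Adj a b ∧ G.Adj b c ∧ G.Adj c a
    · refine iff_of_true (fun h => ?_) (Or.inl hG)
      obtain ⟨a, b, c, hab, hbc, hca⟩ := hG
      exact ChromaticGraphCohomology.not_saturatedAt_three_of_triangle G hab hbc hca
        (htor.1 h 3 (by norm_num))
    · rw [or_iff_right hG, not_iff_not, htor,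
        ChromaticGraphCohomology.torsion_squareH1_eq_bot_iff_saturatedAt G
          fun a b c hab hbc hca => hG ⟨a, b, c, hab, hbc, hca⟩]
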